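/- **Setting.** Let $\Omega\subset\mathbb R^2$ be a bounded polygonal domain with Lipschitz boundary $\Gamma=\overline{\Gamma_1}\cup\overline{\Gamma_2}\cup\overline{\Gamma_3}$, where $\Gamma_1,\Gamma_2,\Gamma_3$ are relatively open in $\Gamma$ and mutually disjoint and $\Gamma_1$ has positive length. Let $\kappa\in(0,\tfrac12)$ and $l\in\{0,1\}$. Let $\mathcal T_h$ be a (conforming) triangulation of $\overline\Omega$ all of whose angles are at least $\theta_0>0$. Put $h_K=\operatorname{diam}K$ for $K\in\mathcal T_h$, let $h_e$ be the length of an edge $e$, and let $\mathcal E_h^0$ be the set of all element edges that lie neither on $\overline{\Gamma_2}$ nor on $\overline{\Gamma_3}$. Let $(\eta_e)_{e\in\mathcal E_h^0}$ be penalty parameters with $0<\eta_e\le\eta_1$, and let $\eta=\eta_e$ on $e$. *Spaces.* Let $H^1_{\Gamma_1}(\Omega)=\{v\in H^1(\Omega): v=0\text{ a.e. on }\Gamma_1\}$ and $$V=\{v\in H^1_{\Gamma_1}(\Omega): v|_K\in H^2(K)\ \forall K\in\mathcal T_h\},\quad V_h=\{v\in H^1_{\Gamma_1}(\Omega): v|_K\in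 P_2(K)\ \forall K\in\mathcal T_h\},\quad V(h)=V_h+V\cap H^3(\Omega),$$ and let $\boldsymbol\Sigma_h$ be the space of symmetric $\boldsymbol\tau\in L^2(\Omega)^{2\times2}$ with $\tau_{ij}|_K\in P_l(K)$ for all $K\in\mathcal T_h$. *Jumps, averages, liftings.* Write $A:B=\sum_{i,j}A_{ij}B_{ij}$, and let $\nabla_h^2v$ be the elementwise Hessian. Let $e$ be an edge. Sums over $K\ni e$ run over the one (if $e\subset\Gamma$) or two (otherwise) elements having $e$ as an edge, and $\boldsymbol n_K$ is the unit outward normal of $K$ on $e$. On $e$ put $$[\![\nabla v]\!]=\sum_{K\ni e}\tfrac12\big(\nabla v|_K\otimes\boldsymbol n_K+\boldsymbol n_K\otimes\nabla v|_K\big),$$ and let $\{\boldsymbol\tau\}$ be the mean of the traces $\boldsymbol\tau|_K$, $K\ni e$. Define $\boldsymbol r_0([\![\nabla v]\!])$ and, for each $e$, $\boldsymbol r_e([\![\nabla v]\!])$ in $\boldsymbol\Sigma_h$ by $$\int_\Omega\boldsymbol r_0([\![\nabla v]\!]):\boldsymbol\tau\,dx=-\int_{\mathcal E_h^0}[\![\nabla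 v]\!]:\{\boldsymbol\tau\}\,ds,\qquad \int_\Omega\boldsymbol r_e([\![\nabla v]\!]):\boldsymbol\tau\,dx=-\int_{e}[\![\nabla v]\!]:\{\boldsymbol\tau\}\,ds\qquad\forall\,\boldsymbol\tau\in\boldsymbol\Sigma_h.$$ *Forms.* With $\mathbb C\boldsymbol\tau=(1-\kappa)\boldsymbol\tau+\kappa\,{\rm tr}(\boldsymbol\tau)\boldsymbol I$, let $$a_h(w,v)=\int_\Omega(1-\kappa)\nabla_h^2w:\nabla_h^2v\,dx+\int_\Omega\kappa\,{\rm tr}(\nabla_h^2w)\,{\rm tr}(\nabla_h^2v)\,dx,\qquad E(w,v)=\int_{\mathcal E_h^0}[\![\nabla w]\!]:\mathbb C\{\nabla_h^2v\}\,ds,$$ $$P(w,v)=\int_{\mathcal E_h^0}\eta h_e^{-1}[\![\nabla w]\!]:[\![\nabla v]\!]\,ds,\qquad R_0(w,v)=\int_\Omega\boldsymbol r_0([\![\nabla v]\!]):\mathbb C\,\boldsymbol r_0([\![\nabla w]\!])\,dx,$$ $$R(w,v)=\sum_{e\in\mathcal E_h^0}\int_\Omega\eta_e\big((1-\kappa)\,\boldsymbol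 r_e([\![\nabla w]\!]):\boldsymbol r_e([\![\nabla v]\!])+\kappa\,{\rm tr}(\boldsymbol r_e([\![\nabla w]\!]))\,{\rm tr}(\boldsymbol r_e([\![\nabla v]\!]))\big)\,dx,$$ and $$\begin{aligned} B^{(1)}_{1,h}(w,v)&=a_h(w,v)-E(w,v)-E(v,w)+P(w,v),\\ B^{(2)}_{1,h}(w,v)&=a_h(w,v)+E(w,v)-E(v,w)+P(w,v),\\ B^{(3)}_{1,h}(w,v)&=a_h(w,v)-E(w,v)-E(v,w)+R_0(w,v)+R(w,v),\\ B^{(4)}_{1,h}(w,v)&=a_h(w,v)-E(w,v)-E(v,w)+R(w,v),\\ B^{(5)}_{1,h}(w,v)&=a_h(w,v)-E(w,v)-E(v,w)+R_0(w,v)+P(w,v). \end{aligned}$$ *Norm.* For $v\in V(h)$ let $$|||v|||^2=\sum_{K\in\mathcal T_h}|v|_{2,K}^2+\sum_{e\in\mathcal E_h^0}h_e^{-1}\|[\![\nabla v]\!]\|_{0,e}^2+\sum_{K\in\mathcal T_h}h_K^2|v|_{3,K}^2,$$ where $|v|_{m,K}$ is the $L^2(K)$ norm of the full tensor of derivatives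 of order $m$. **Lemma (Boundedness).** For all $\theta_0,\eta_1>0$ there is a constant $C>0$, depending only on $\theta_0$ and $\eta_1$ (in particular not on $h$), such that in the setting above, for every $j=1,\dots,5$, $$B^{(j)}_{1,h}(w,v)\le C\,|||w|||\,|||v|||\qquad\forall\,(w,v)\in V(h)\times V(h).$$ -/

import Mathlib

open MeasureTheory Filter Topology
open scoped ENNReal ContDiff Pointwise

noncomputable section

namespace KirchhoffDG

/-- The Euclidean plane. -/
abbrev Plane : Type := EuclideanSpace ℝ (Fin 2)

/-- Real two by two matrices. -/
abbrev Mat : Type := Matrix (Fin 2) (Fin 2) ℝ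

/-- The double dot product `A : B` of two matrices. -/
def ddot (A B : Mat) : ℝ := ∑ i, ∑ j, A i j * B i j

/-- Arc length: the one-dimensional Hausdorff measure in the plane. -/
def arcLength : Measure Plane := Measure.hausdorffMeasure 1

/-! ### Weak derivatives, Sobolev spaces and traces -/

/-- The classical partial derivative in the `i`-th coordinate direction. -/
def partialDeriv (i : Fin 2) (φ : Plane → ℝ) (x : Plane) : ℝ :=
  fderiv ℝ φ x (EuclideanSpace.single i 1)

/-- `g` is the weak partial derivative `∂ᵢ f` in the open set `U`. -/
def IsWeakDeriv (U : Set Plane) (i : Fin 2) (f g : Plane → ℝ) : Prop :=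
  LocallyIntegrableOn f U ∧ LocallyIntegrableOn g U ∧
    ∀ φ : Plane → ℝ, ContDiff ℝ ∞ φ → HasCompactSupport φ → tsupport φ ⊆ U →
      ∫ x in U, f x * partialDeriv i φ x = -∫ x in U, g x * φ x

open Classical in
/-- The weak partial derivative `∂ᵢ f` in the open set `U` (it is unique almost everywhere in `U`;
zero if there is none). -/
def weakDeriv (U : Set Plane) (i : Fin 2) (f : Plane → ℝ) : Plane → ℝ :=
  if h : ∃ g, IsWeakDeriv U i f g then h.choose else 0

/-- Membership in the Sobolev space `H^m(U)`: the function and all its weak derivatives up to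
order `m` are square integrable in `U`. -/
def MemSobolev : ℕ → Set Plane → (Plane → ℝ) → Prop
  | 0, U, f => MemLp f 2 (volume.restrict U)
  | m + 1, U, f => MemLp f 2 (volume.restrict U) ∧
      ∀ i, ∃ g, IsWeakDeriv U i f g ∧ MemSobolev m U g

/-- The Sobolev space `H^m(U)` as a set of functions. -/
def Sobolev (m : ℕ) (U : Set Plane) : Set (Plane → ℝ) := {f | MemSobolev m U f}

/-- `t ∈ L²(S)` is the trace on the boundary piece `S ⊆ ∂U` of `f ∈ H¹(U)`: it is the limit in
`L²(S)` of the restrictions of functions, smooth up to the boundary, that converge to `f`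
in `H¹(U)`. -/
def IsTrace (U S : Set Plane) (f t : Plane → ℝ) : Prop :=
  MemSobolev 1 U f ∧ MemLp t 2 (arcLength.restrict S) ∧
    ∃ φ : ℕ → Plane → ℝ, (∀ n, ContDiff ℝ ∞ (φ n)) ∧
      Tendsto (fun n => eLpNorm (φ n - f) 2 (volume.restrict U)) atTop (𝓝 0) ∧
      (∀ i, Tendsto (fun n => eLpNorm (partialDeriv i (φ n) - weakDeriv U i f) 2
        (volume.restrict U)) atTop (𝓝 0)) ∧
      Tendsto (fun n => eLpNorm (φ n - t) 2 (arcLength.restrict S)) atTop (𝓝 0)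

open Classical in
/-- The trace of `f` on `S ⊆ ∂U` (unique almost everywhere on `S`; zero if there is none). -/
def trace (U S : Set Plane) (f : Plane → ℝ) : Plane → ℝ :=
  if h : ∃ t, IsTrace U S f t then h.choose else 0

/-- The (weak) Hessian of `v` in `U`. -/
def hessian (U : Set Plane) (v : Plane → ℝ) (x : Plane) : Mat :=
  Matrix.of fun i j => weakDeriv U j (weakDeriv U i v) x

/-- The (weak) third derivative `∂ₖ ∂ⱼ ∂ᵢ v` in `U`. -/
def thirdDeriv (U : Set Plane) (v : Plane → ℝ) (i j k : Fin 2) : Plane → ℝ :=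
  weakDeriv U k (weakDeriv U j (weakDeriv U i v))

/-- The trace on `S ⊆ ∂U` of the gradient in `U`. -/
def gradTrace (U S : Set Plane) (v : Plane → ℝ) (x : Plane) : Fin 2 → ℝ :=
  fun i => trace U S (weakDeriv U i v) x

/-- The entrywise trace on `S ⊆ ∂U` of a matrix-valued function. -/
def matTrace (U S : Set Plane) (τ : Plane → Mat) (x : Plane) : Mat :=
  Matrix.of fun i j => trace U S (fun y => τ y i j) x

/-- `f` agrees almost everywhere on `U` with a polynomial of total degree at most `m`. -/
def IsPolyOn (m : ℕ) (U : Set Plane) (f : Plane → ℝ) : Prop :=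
  ∃ p : MvPolynomial (Fin 2) ℝ, p.totalDegree ≤ m ∧
    ∀ᵐ x ∂(volume.restrict U), f x = MvPolynomial.eval (fun k => x k) p

/-! ### The domain and the decomposition of its boundary -/

/-- The boundary of `Ω` is locally, in suitable Cartesian coordinates, the graph of a Lipschitz
function, with `Ω` lying strictly above the graph. -/
def HasLipschitzBoundary (Ω : Set Plane) : Prop :=
  ∀ x ∈ frontier Ω, ∃ (A : Plane ≃ₗᵢ[ℝ] Plane) (γ : ℝ → ℝ) (L : NNReal) (r : ℝ),
    LipschitzWith L γ ∧ 0 < r ∧ ∀ y ∈ Metric.ball x r, y ∈ Ω ↔ γ (A y 0) < A y 1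

/-- A bounded polygonal domain with Lipschitz boundary. -/
structure IsPolygonalDomain (Ω : Set Plane) : Prop where
  isOpen : IsOpen Ω
  isConnected : IsConnected Ω
  isBounded : Bornology.IsBounded Ω
  polygonal : ∃ S : Finset (Plane × Plane), frontier Ω = ⋃ p ∈ S, segment ℝ p.1 p.2
  lipschitz : HasLipschitzBoundary Ω

/-- The boundary of `Ω` is decomposed into the closures of three mutually disjoint, relatively
open parts, the first of which has positive length. -/
structure IsBoundaryDecomposition (Ω Γ₁ Γ₂ Γ₃ : Set Plane) : Prop where
  relOpen₁ : ∃ O, IsOpen O ∧ Γ₁ = O ∩ frontier Ω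
  relOpen₂ : ∃ O, IsOpen O ∧ Γ₂ = O ∩ frontier Ω
  relOpen₃ : ∃ O, IsOpen O ∧ Γ₃ = O ∩ frontier Ω
  disjoint₁₂ : Disjoint Γ₁ Γ₂
  disjoint₁₃ : Disjoint Γ₁ Γ₃
  disjoint₂₃ : Disjoint Γ₂ Γ₃
  cover : frontier Ω = closure Γ₁ ∪ closure Γ₂ ∪ closure Γ₃
  meas_pos : 0 < arcLength Γ₁

/-- The space of all `v ∈ H¹(Ω)` that vanish almost everywhere on `Γ₁`. -/
def HOneZero (Ω Γ₁ : Set Plane) : Set (Plane → ℝ) :=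
  {v | MemSobolev 1 Ω v ∧
    ∃ t, IsTrace Ω (frontier Ω) v t ∧ ∀ᵐ x ∂(arcLength.restrict Γ₁), t x = 0}

/-! ### Triangulations -/

/-- A (conforming) triangulation of the closure of `Ω`: a finite simplicial complex whose
underlying space is `closure Ω`. Simplices are given by their sets of vertices. -/
structure Triangulation (Ω : Set Plane) where
  /-- The underlying simplicial complex. -/
  complex : Geometry.SimplicialComplex ℝ Plane
  finite_faces : complex.faces.Finite
  space_eq : complex.space = closure Ω

/-- The closed triangle or segment spanned by a set of vertices. -/
def hull (s : Finset Plane) : Set Plane := convexHull ℝ (s : Set Plane)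

/-- The open triangle spanned by three vertices. -/
def cell (K : Finset Plane) : Set Plane := interior (hull K)

/-- The diameter `h_K` of an element, which for an edge is its length `h_e`. -/
def size (s : Finset Plane) : ℝ := Metric.diam (hull s)

/-- `n` is the unit outward normal on the edge `e` of the triangle `K`. -/
def IsOuterNormal (K e : Finset Plane) (n : Plane) : Prop :=
  ‖n‖ = 1 ∧ (∀ x ∈ e, ∀ y ∈ e, inner ℝ n (y - x) = 0) ∧
    ∀ x ∈ e, ∀ y ∈ K, y ∉ e → inner ℝ n (y - x) < 0

open Classical in
/-- The unit outward normal on the edge `e` of the triangle `K`, as a coordinate vector. -/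
def outerNormal (K e : Finset Plane) : Fin 2 → ℝ :=
  if h : ∃ n, IsOuterNormal K e n then fun i => h.choose i else 0

namespace Triangulation

variable {Ω : Set Plane} (T : Triangulation Ω)

open Classical in
/-- The elements `K ∈ 𝒯_h`, that is, the triangles. -/
def elements : Finset (Finset Plane) := T.finite_faces.toFinset.filter fun K => K.card = 3

open Classical in
/-- The set `ℰ_h` of all element edges. -/
def edges : Finset (Finset Plane) :=
  T.finite_faces.toFinset.filter fun e => e.card = 2 ∧ ∃ K ∈ T.elements, e ⊆ K

open Classical in
/-- The set `ℰ_h⁰` of all edges that do not lie on the closure of `Γ₂` or of `Γ₃`. -/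
def edges₀ (Γ₂ Γ₃ : Set Plane) : Finset (Finset Plane) :=
  T.edges.filter fun e => ¬ (hull e ⊆ closure Γ₂ ∨ hull e ⊆ closure Γ₃)

open Classical in
/-- The elements having `e` as an edge: two for an interior edge, one for a boundary edge. -/
def adjacent (e : Finset Plane) : Finset (Finset Plane) := T.elements.filter fun K => e ⊆ K

/-- All angles of all the triangles are at least `θ₀`. -/
def MinAngle (θ₀ : ℝ) : Prop :=
  ∀ K ∈ T.elements, ∀ a ∈ K, ∀ b ∈ K, ∀ c ∈ K, a ≠ b → b ≠ c → a ≠ c →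
    θ₀ ≤ EuclideanGeometry.angle a b c

/-- The integral over `Ω` of a function `F` given elementwise: it is `F K` on the element `K`. -/
def integral (F : Finset Plane → Plane → ℝ) : ℝ :=
  ∑ K ∈ T.elements, ∫ x in cell K, F K x

/-- The jump of the gradient on the edge `e`: the sum, over the elements adjacent to `e`, of the
symmetrized tensor products of the gradient and the outward normal. -/
def jump (v : Plane → ℝ) (e : Finset Plane) (x : Plane) : Mat :=
  ∑ K ∈ T.adjacent e, (1 / 2 : ℝ) •
    (Matrix.vecMulVec (gradTrace (cell K) (hull e) v x) (outerNormal K e) +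
      Matrix.vecMulVec (outerNormal K e) (gradTrace (cell K) (hull e) v x))

/-- The average on the edge `e` of a matrix field that is equal to `τ K` on the element `K`: the
mean of the two one-sided traces on an interior edge, the only trace on a boundary edge. -/
def average (τ : Finset Plane → Plane → Mat) (e : Finset Plane) (x : Plane) : Mat :=
  ((T.adjacent e).card : ℝ)⁻¹ • ∑ K ∈ T.adjacent e, matTrace (cell K) (hull e) (τ K) x

/-- The piecewise Hessian of `v`, element by element. -/
def brokenHessian (v : Plane → ℝ) (K : Finset Plane) (x : Plane) : Mat := hessian (cell K) v x

/-! ### Discrete spaces -/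

/-- The space `Σ_h` of symmetric, square integrable matrix fields whose entries are polynomials of
degree at most `l` on each element. -/
def SigmaH (l : ℕ) : Set (Plane → Mat) :=
  {τ | (∀ i j, MemLp (fun x => τ x i j) 2 (volume.restrict Ω)) ∧
    (∀ᵐ x ∂(volume.restrict Ω), (τ x).IsSymm) ∧
    ∀ K ∈ T.elements, ∀ i j, IsPolyOn l (cell K) fun x => τ x i j}

/-- The space `V` of functions in `H¹(Ω)` that vanish on `Γ₁` and are in `H²` on each element. -/
def V (Γ₁ : Set Plane) : Set (Plane → ℝ) :=
  {v | v ∈ HOneZero Ω Γ₁ ∧ ∀ K ∈ T.elements, v ∈ Sobolev 2 (cell K)}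

/-- The finite element space `V_h` of functions in `H¹(Ω)` that vanish on `Γ₁` and are
polynomials of degree at most two on each element. -/
def Vh (Γ₁ : Set Plane) : Set (Plane → ℝ) :=
  {v | v ∈ HOneZero Ω Γ₁ ∧ ∀ K ∈ T.elements, IsPolyOn 2 (cell K) v}

/-- The space `V(h) = V_h + V ∩ H³(Ω)`. -/
def VSum (Γ₁ : Set Plane) : Set (Plane → ℝ) := T.Vh Γ₁ + (T.V Γ₁ ∩ Sobolev 3 Ω)

/-! ### Lifting operators -/

/-- `r ∈ Σ_h` is the lifting of the field `φ`, given edge by edge, on the set `E` of edges. -/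
def IsLifting (l : ℕ) (E : Finset (Finset Plane)) (φ : Finset Plane → Plane → Mat)
    (r : Plane → Mat) : Prop :=
  r ∈ T.SigmaH l ∧ ∀ τ ∈ T.SigmaH l,
    T.integral (fun _ x => ddot (r x) (τ x)) =
      -∑ e ∈ E, ∫ x in hull e, ddot (φ e x) (T.average (fun _ => τ) e x) ∂arcLength

open Classical in
/-- The lifting into `Σ_h` of a symmetric square integrable field on a set `E` of edges
(it exists and is unique almost everywhere, by the Riesz representation theorem in the
finite-dimensional space `Σ_h`). -/
def lifting (l : ℕ) (E : Finset (Finset Plane)) (φ : Finset Plane → Plane → Mat) :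
    Plane → Mat :=
  if h : ∃ r, T.IsLifting l E φ r then h.choose else 0

/-- The global lifting `r₀(⟦∇v⟧)`, over all the edges in `ℰ_h⁰`. -/
def globalLift (l : ℕ) (Γ₂ Γ₃ : Set Plane) (v : Plane → ℝ) : Plane → Mat :=
  T.lifting l (T.edges₀ Γ₂ Γ₃) (T.jump v)

/-- The local lifting `r_e(⟦∇v⟧)`, over the single edge `e`. -/
def localLift (l : ℕ) (e : Finset Plane) (v : Plane → ℝ) : Plane → Mat :=
  T.lifting l {e} (T.jump v)

/-! ### The mesh-dependent norms -/

/-- The square of the seminorm `|v|_*`. -/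
def starSq (Γ₂ Γ₃ : Set Plane) (v : Plane → ℝ) : ℝ :=
  T.integral (fun K x => ddot (brokenHessian v K x) (brokenHessian v K x)) +
    ∑ e ∈ T.edges₀ Γ₂ Γ₃,
      (size e)⁻¹ * ∫ x in hull e, ddot (T.jump v e x) (T.jump v e x) ∂arcLength

/-- The mesh-dependent energy norm `|||v|||`. -/
def energyNorm (Γ₂ Γ₃ : Set Plane) (v : Plane → ℝ) : ℝ :=
  Real.sqrt (T.starSq Γ₂ Γ₃ v + ∑ K ∈ T.elements,
    size K ^ 2 * ∑ i, ∑ j, ∑ k, ∫ x in cell K, thirdDeriv (cell K) v i j k x ^ 2)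

/-! ### The bilinear forms -/

/-- The map `τ ↦ (1 - κ) τ + κ tr(τ) I`. -/
def elastic (κ : ℝ) (τ : Mat) : Mat := (1 - κ) • τ + (κ * τ.trace) • (1 : Mat)

/-- `∫_Ω (1 - κ) ∇_h² w : ∇_h² v dx + ∫_Ω κ tr(∇_h² w) tr(∇_h² v) dx`. -/
def bulkForm (κ : ℝ) (w v : Plane → ℝ) : ℝ :=
  T.integral (fun K x => (1 - κ) * ddot (brokenHessian w K x) (brokenHessian v K x)) +
    T.integral (fun K x =>
      κ * ((brokenHessian w K x).trace * (brokenHessian v K x).trace))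

/-- `∫_{ℰ_h⁰} ⟦∇w⟧ : ((1 - κ) {∇_h² v} + κ tr({∇_h² v}) I) ds`. -/
def edgeForm (κ : ℝ) (Γ₂ Γ₃ : Set Plane) (w v : Plane → ℝ) : ℝ :=
  ∑ e ∈ T.edges₀ Γ₂ Γ₃, ∫ x in hull e,
    ddot (T.jump w e x) (elastic κ (T.average (brokenHessian v) e x)) ∂arcLength

/-- `∫_{ℰ_h⁰} η h_e⁻¹ ⟦∇w⟧ : ⟦∇v⟧ ds`. -/
def penaltyForm (η : Finset Plane → ℝ) (Γ₂ Γ₃ : Set Plane) (w v : Plane → ℝ) : ℝ :=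
  ∑ e ∈ T.edges₀ Γ₂ Γ₃, ∫ x in hull e,
    η e * (size e)⁻¹ * ddot (T.jump w e x) (T.jump v e x) ∂arcLength

/-- `∫_Ω r₀(⟦∇v⟧) : ((1 - κ) r₀(⟦∇w⟧) + κ tr(r₀(⟦∇w⟧)) I) dx`. -/
def globalLiftForm (κ : ℝ) (l : ℕ) (Γ₂ Γ₃ : Set Plane) (w v : Plane → ℝ) : ℝ :=
  T.integral fun _ x =>
    ddot (T.globalLift l Γ₂ Γ₃ v x) (elastic κ (T.globalLift l Γ₂ Γ₃ w x))

/-- `∑_{e ∈ ℰ_h⁰} ∫_Ω η ((1 - κ) r_e(⟦∇w⟧) : r_e(⟦∇v⟧) + κ tr(r_e(⟦∇w⟧)) tr(r_e(⟦∇v⟧))) dx`. -/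
def localLiftForm (κ : ℝ) (η : Finset Plane → ℝ) (l : ℕ) (Γ₂ Γ₃ : Set Plane)
    (w v : Plane → ℝ) : ℝ :=
  ∑ e ∈ T.edges₀ Γ₂ Γ₃, T.integral fun _ x =>
    η e * ((1 - κ) * ddot (T.localLift l e w x) (T.localLift l e v x) +
      κ * ((T.localLift l e w x).trace * (T.localLift l e v x).trace))

/-- The primal forms `B_{1,h}^{(1)}, …, B_{1,h}^{(5)}`, numbered here from `0` to `4`: the `C⁰`
interior penalty form, the non-symmetric interior penalty form, the form of Wells and Dung,
the form extended from Bassi et al., and the local `C⁰` discontinuous Galerkin form. -/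
def primalForm (κ : ℝ) (η : Finset Plane → ℝ) (l : ℕ) (Γ₂ Γ₃ : Set Plane) (j : Fin 5)
    (w v : Plane → ℝ) : ℝ :=
  match j with
  | 0 => T.bulkForm κ w v - T.edgeForm κ Γ₂ Γ₃ w v - T.edgeForm κ Γ₂ Γ₃ v w
      + T.penaltyForm η Γ₂ Γ₃ w v
  | 1 => T.bulkForm κ w v + T.edgeForm κ Γ₂ Γ₃ w v - T.edgeForm κ Γ₂ Γ₃ v w
      + T.penaltyForm η Γ₂ Γ₃ w v
  | 2 => T.bulkForm κ w v - T.edgeForm κ Γ₂ Γ₃ w v - T.edgeForm κ Γ₂ Γ₃ v w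
      + T.globalLiftForm κ l Γ₂ Γ₃ w v + T.localLiftForm κ η l Γ₂ Γ₃ w v
  | 3 => T.bulkForm κ w v - T.edgeForm κ Γ₂ Γ₃ w v - T.edgeForm κ Γ₂ Γ₃ v w
      + T.localLiftForm κ η l Γ₂ Γ₃ w v
  | 4 => T.bulkForm κ w v - T.edgeForm κ Γ₂ Γ₃ w v - T.edgeForm κ Γ₂ Γ₃ v w
      + T.globalLiftForm κ l Γ₂ Γ₃ w v + T.penaltyForm η Γ₂ Γ₃ w v

end Triangulation

end KirchhoffDG

end

/-!
Every term of the primal forms is estimated by the Cauchy-Schwarz inequality, after which two trace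
inequalities on a single triangle `K` with an edge `e` remain to be proved, with a constant `C` that
depends on the minimal angle only:

* `h_e ‖f‖²_{0,e} ≤ C (‖f‖²_{0,K} + h_K² ‖∇f‖²_{0,K})` for `f ∈ H¹(K)`
  (`IsEdgeOf.integral_trace_sq_le`), applied to the entries of the broken Hessian, which explains
  the third order term in the energy norm;
* `h_e ‖p‖²_{0,e} ≤ C ‖p‖²_{0,K}` for `p` of degree at most one
  (`IsEdgeOf.integral_trace_sq_le_of_isPolyOn`), applied to the liftings.

Both are proved in the same way. Each half of `e` is translated inside `K`, towards the vertex
opposite to `e`, by half of the adjacent side, so that it sweeps out a parallelogram contained in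
`K`. On each line of the parallelogram in the direction of translation one uses
`g(0)² ≤ ∫₀¹ (2 g² + g'²)`, or `g(0)² ≤ 4 ∫₀¹ g²` for affine `g`, and integrates along the half edge
(`lintegral_edge_le`). The Jacobian is controlled by the height of `K` over `e`, which is at least
`(sin θ / 2) h_K` (`IsAdmissible.le_det`). The first inequality passes from smooth functions to `H¹`
because traces are defined as limits (`IsAdmissible.sqNorm_trace_sub_le`); applied to the difference
of a function and a polynomial, it also shows that the trace of a polynomial is its restriction.

A lifting `r` of the jumps is bounded by testing its definition with `r` itself and applying the
second inequality to the averages of `r` (`Triangulation.lifting_bound`). In sums over edges each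
triangle is counted at most three times (`Triangulation.sum_edges_sum_adjacent_le`).

Traces of `H¹` functions and liftings do exist, but the estimates do not rely on it: they are proved
for whichever traces and liftings there are, and the value zero, which the definitions take
otherwise, satisfies them too.
-/

namespace KirchhoffDG

/-! ### Weak derivatives and Sobolev functions -/

theorem integrableOn_mul_of_tsupport_subset {U : Set Plane} {f φ : Plane → ℝ}
    (hf : LocallyIntegrableOn f U) (hφ : Continuous φ) (hc : HasCompactSupport φ)
    (hU : tsupport φ ⊆ U) : IntegrableOn (fun x => f x * φ x) U := by
  have h1 : IntegrableOn (fun x => f x * φ x) (tsupport φ) :=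
    (hf.integrableOn_compact_subset hU hc).mul_continuousOn hφ.continuousOn hc
  refine IntegrableOn.of_forall_sdiff_eq_zero h1 ?_ ?_ |>.mono_set (Set.subset_univ U)
  · exact MeasurableSet.univ
  · intro x hx
    simp [image_eq_zero_of_notMem_tsupport hx.2]

theorem continuous_partialDeriv {i : Fin 2} {φ : Plane → ℝ} (hφ : ContDiff ℝ ∞ φ) :
    Continuous (partialDeriv i φ) :=
  (hφ.continuous_fderiv (by simp)).clm_apply continuous_const

theorem contDiff_partialDeriv {i : Fin 2} {φ : Plane → ℝ} (hφ : ContDiff ℝ ∞ φ) :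
    ContDiff ℝ ∞ (partialDeriv i φ) :=
  (hφ.fderiv_right (m := ∞) (by simp)).clm_apply contDiff_const

theorem tsupport_partialDeriv_subset (i : Fin 2) (φ : Plane → ℝ) :
    tsupport (partialDeriv i φ) ⊆ tsupport φ :=
  tsupport_fderiv_apply_subset ℝ _

theorem hasCompactSupport_partialDeriv (i : Fin 2) {φ : Plane → ℝ} (hφ : HasCompactSupport φ) :
    HasCompactSupport (partialDeriv i φ) :=
  hφ.fderiv_apply ℝ _

/-- Weak derivatives are unique, by the fundamental lemma of the calculus of variations. -/
theorem IsWeakDeriv.ae_eq {U : Set Plane} (hU : IsOpen U) {i : Fin 2} {f g₁ g₂ : Plane → ℝ}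
    (h₁ : IsWeakDeriv U i f g₁) (h₂ : IsWeakDeriv U i f g₂) :
    g₁ =ᵐ[volume.restrict U] g₂ := by
  have key := hU.ae_eq_zero_of_integral_contDiff_smul_eq_zero (μ := volume.restrict U)
    (f := g₁ - g₂) ?_ ?_
  · have h := ae_restrict_mem (μ := volume) hU.measurableSet
    filter_upwards [key, h] with x hx hxU
    exact sub_eq_zero.1 (hx hxU)
  · exact (h₁.2.1.sub h₂.2.1).mono_measure Measure.restrict_le_self
  · intro φ hφ hc hs
    have e := (h₁.2.2 φ hφ hc hs).symm.trans (h₂.2.2 φ hφ hc hs)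
    have : ∀ x, φ x • (g₁ - g₂) x = g₁ x * φ x - g₂ x * φ x := by
      intro x; simp; ring
    simp_rw [this]
    rw [integral_sub (integrableOn_mul_of_tsupport_subset h₁.2.1 hφ.continuous hc hs)
      (integrableOn_mul_of_tsupport_subset h₂.2.1 hφ.continuous hc hs)]
    linarith

theorem IsWeakDeriv.isWeakDeriv_weakDeriv {U : Set Plane} {i : Fin 2} {f g : Plane → ℝ}
    (h : IsWeakDeriv U i f g) : IsWeakDeriv U i f (weakDeriv U i f) := by
  have h' : ∃ g, IsWeakDeriv U i f g := ⟨g, h⟩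
  rw [weakDeriv, dif_pos h']
  exact h'.choose_spec

theorem IsWeakDeriv.congr {U : Set Plane} {i : Fin 2} {f f' g : Plane → ℝ}
    (h : IsWeakDeriv U i f g) (hf : f =ᵐ[volume.restrict U] f') : IsWeakDeriv U i f' g := by
  refine ⟨h.1.congr hf, h.2.1, fun φ h1 h2 h3 => ?_⟩
  rw [← h.2.2 φ h1 h2 h3]
  refine integral_congr_ae ?_
  filter_upwards [hf] with x hx
  rw [hx]

theorem IsWeakDeriv.add {U : Set Plane} {i : Fin 2} {f f' g g' : Plane → ℝ}
    (h : IsWeakDeriv U i f g) (h' : IsWeakDeriv U i f' g') :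
    IsWeakDeriv U i (f + f') (g + g') := by
  refine ⟨h.1.add h'.1, h.2.1.add h'.2.1, fun φ h1 h2 h3 => ?_⟩
  have hp := continuous_partialDeriv (i := i) h1
  have hpc := hasCompactSupport_partialDeriv i h2
  have hps := (tsupport_partialDeriv_subset i φ).trans h3
  simp only [Pi.add_apply, add_mul]
  rw [integral_add (integrableOn_mul_of_tsupport_subset h.1 hp hpc hps)
      (integrableOn_mul_of_tsupport_subset h'.1 hp hpc hps),
    integral_add (integrableOn_mul_of_tsupport_subset h.2.1 h1.continuous h2 h3)
      (integrableOn_mul_of_tsupport_subset h'.2.1 h1.continuous h2 h3),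
    h.2.2 φ h1 h2 h3, h'.2.2 φ h1 h2 h3]
  ring

theorem isWeakDeriv_partialDeriv (U : Set Plane) (i : Fin 2) {f : Plane → ℝ}
    (hf : ContDiff ℝ ∞ f) : IsWeakDeriv U i f (partialDeriv i f) := by
  have hfp := continuous_partialDeriv (i := i) hf
  refine ⟨hf.continuous.locallyIntegrable.locallyIntegrableOn _,
    hfp.locallyIntegrable.locallyIntegrableOn _, fun φ h1 h2 h3 => ?_⟩
  have hp := continuous_partialDeriv (i := i) h1
  have hpc := hasCompactSupport_partialDeriv i h2
  rw [setIntegral_eq_integral_of_forall_compl_eq_zero,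
    setIntegral_eq_integral_of_forall_compl_eq_zero]
  · refine integral_mul_fderiv_eq_neg_fderiv_mul_of_integrable ?_ ?_ ?_ ?_ ?_
    · exact (hfp.mul h1.continuous).integrable_of_hasCompactSupport h2.mul_left
    · exact (hf.continuous.mul hp).integrable_of_hasCompactSupport hpc.mul_left
    · exact (hf.continuous.mul h1.continuous).integrable_of_hasCompactSupport h2.mul_left
    · exact fun x _ => hf.differentiable (by simp) x
    · exact fun x _ => h1.differentiable (by simp) x
  · intro x hx
    rw [image_eq_zero_of_notMem_tsupport (fun h => hx (h3 h)), mul_zero]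
  · intro x hx
    rw [image_eq_zero_of_notMem_tsupport (f := partialDeriv i φ)
      (fun h => hx (h3 (tsupport_partialDeriv_subset i φ h))), mul_zero]

theorem memLp_two_of_continuous_of_isBounded {U : Set Plane} (hb : Bornology.IsBounded U)
    {f : Plane → ℝ} (hf : Continuous f) : MemLp f 2 (volume.restrict U) := by
  have hc : IsCompact (closure U) := hb.isCompact_closure
  have h : MemLp f 2 (volume.restrict (closure U)) :=
    (memLp_two_iff_integrable_sq hf.aestronglyMeasurable).2
      ((hf.pow 2).continuousOn.integrableOn_compact hc)
  exact h.mono_measure (Measure.restrict_mono subset_closure le_rfl)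

theorem MemSobolev.memLp {m : ℕ} {U : Set Plane} {f : Plane → ℝ} (h : MemSobolev m U f) :
    MemLp f 2 (volume.restrict U) := by
  cases m with
  | zero => exact h
  | succ m => exact h.1

theorem MemSobolev.congr {m : ℕ} {U : Set Plane} {f f' : Plane → ℝ} (h : MemSobolev m U f)
    (hf : f =ᵐ[volume.restrict U] f') : MemSobolev m U f' := by
  cases m with
  | zero => exact MemLp.ae_eq hf h
  | succ m =>
    refine ⟨h.1.ae_eq hf, fun i => ?_⟩
    obtain ⟨g, hg, hg'⟩ := h.2 i
    exact ⟨g, hg.congr hf, hg'⟩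

theorem MemSobolev.add {m : ℕ} {U : Set Plane} {f f' : Plane → ℝ} (h : MemSobolev m U f)
    (h' : MemSobolev m U f') : MemSobolev m U (f + f') := by
  induction m generalizing f f' with
  | zero => exact MemLp.add h h'
  | succ m ih =>
    refine ⟨h.1.add h'.1, fun i => ?_⟩
    obtain ⟨g, hg, hgm⟩ := h.2 i
    obtain ⟨g', hg', hgm'⟩ := h'.2 i
    exact ⟨g + g', hg.add hg', ih hgm hgm'⟩

theorem MemSobolev.weakDeriv {m : ℕ} {U : Set Plane} (hU : IsOpen U) {f : Plane → ℝ}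
    (h : MemSobolev (m + 1) U f) (i : Fin 2) : MemSobolev m U (weakDeriv U i f) := by
  obtain ⟨g, hg, hgm⟩ := h.2 i
  exact hgm.congr (hg.ae_eq hU hg.isWeakDeriv_weakDeriv)

theorem memSobolev_of_contDiff (m : ℕ) {U : Set Plane} (hb : Bornology.IsBounded U)
    {f : Plane → ℝ} (hf : ContDiff ℝ ∞ f) : MemSobolev m U f := by
  induction m generalizing f with
  | zero => exact memLp_two_of_continuous_of_isBounded hb hf.continuous
  | succ m ih =>
    exact ⟨memLp_two_of_continuous_of_isBounded hb hf.continuous, fun i =>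
      ⟨_, isWeakDeriv_partialDeriv U i hf, ih (contDiff_partialDeriv hf)⟩⟩

theorem weakDeriv_ae_eq_partialDeriv {U : Set Plane} (hU : IsOpen U) (i : Fin 2) {f g : Plane → ℝ}
    (hg : ContDiff ℝ ∞ g) (hfg : f =ᵐ[volume.restrict U] g) :
    weakDeriv U i f =ᵐ[volume.restrict U] partialDeriv i g := by
  have h := (isWeakDeriv_partialDeriv U i hg).congr hfg.symm
  exact h.isWeakDeriv_weakDeriv.ae_eq hU h

theorem contDiff_eval (p : MvPolynomial (Fin 2) ℝ) :
    ContDiff ℝ ∞ fun x : Plane => MvPolynomial.eval (fun k => x k) p := by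
  induction p using MvPolynomial.induction_on with
  | C a => simpa using contDiff_const
  | add p q hp hq => simpa using hp.add hq
  | mul_X p i hp =>
    have : ContDiff ℝ ∞ fun x : Plane => x i := by fun_prop
    simpa using hp.mul this

theorem isOpen_cell (K : Finset Plane) : IsOpen (cell K) := isOpen_interior

theorem isCompact_hull (K : Finset Plane) : IsCompact (hull K) :=
  K.finite_toSet.isCompact_convexHull ℝ

theorem isBounded_cell (K : Finset Plane) : Bornology.IsBounded (cell K) :=
  (isCompact_hull K).isBounded.subset interior_subset

theorem IsPolyOn.memSobolev {k : ℕ} (m : ℕ) {K : Finset Plane} {f : Plane → ℝ}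
    (h : IsPolyOn k (cell K) f) : MemSobolev m (cell K) f := by
  obtain ⟨p, -, hp⟩ := h
  exact (memSobolev_of_contDiff m (isBounded_cell K) (contDiff_eval p)).congr
    (EventuallyEq.symm hp)

/-- Functions in `V(h)` are in `H²` on each element, so their broken Hessians are square
integrable. -/
theorem Triangulation.memLp_brokenHessian {Ω : Set Plane} (T : Triangulation Ω) {Γ₁ : Set Plane}
    {v : Plane → ℝ} (hv : v ∈ T.VSum Γ₁) {K : Finset Plane} (hK : K ∈ T.elements) (i j : Fin 2) :
    MemLp (fun x => brokenHessian v K x i j) 2 (volume.restrict (cell K)) := by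
  obtain ⟨v₁, h₁, v₂, h₂, rfl⟩ := hv
  have h : MemSobolev 2 (cell K) (v₁ + v₂) :=
    ((h₁.2 K hK).memSobolev 2).add (h₂.1.2 K hK)
  exact ((h.weakDeriv (isOpen_cell K) i).weakDeriv (isOpen_cell K) j).memLp

/-! ### Integration along segments and over parallelograms -/

/-- Arc length on a segment, parametrized affinely over the unit interval. -/
theorem arcLength_restrict_segment (a b : Plane) :
    arcLength.restrict (segment ℝ a b) =
      (nndist a b : ℝ≥0∞) • (volume.restrict (Set.Icc (0 : ℝ) 1)).map (AffineMap.lineMap a b) := by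
  have hm : Measurable (AffineMap.lineMap a b : ℝ → Plane) :=
    AffineMap.lineMap_continuous.measurable
  ext s hs
  rw [Measure.restrict_apply hs, Measure.smul_apply, Measure.map_apply hm hs,
    Measure.restrict_apply (hm hs), segment_eq_image_lineMap, ← Set.image_preimage_inter,
    ← hausdorffMeasure_real, arcLength]
  exact hausdorffMeasure_lineMap_image a b _

/-- The determinant of two vectors of the plane. -/
def det2 (u w : Plane) : ℝ := u 0 * w 1 - w 0 * u 1

theorem measurePreserving_coords : MeasurePreserving
    (fun x : Plane => (x 0, x 1)) volume (volume : Measure (ℝ × ℝ)) :=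
  (volume_preserving_finTwoArrow ℝ).comp (PiLp.volume_preserving_ofLp (Fin 2))

/-- Change of variables onto a parallelogram contained in `S`. -/
theorem lintegral_parallelogram_le {F : Plane → ℝ≥0∞} (hF : Measurable F) {S : Set Plane}
    (hS : MeasurableSet S) {a u w : Plane} (hd : det2 u w ≠ 0)
    (hP : ∀ t ∈ Set.Icc (0 : ℝ) 1, ∀ s ∈ Set.Icc (0 : ℝ) 1, a + (t • u + s • w) ∈ S) :
    ∫⁻ t in Set.Icc (0 : ℝ) 1, ∫⁻ s in Set.Icc (0 : ℝ) 1, F (a + (t • u + s • w)) ≤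
      ENNReal.ofReal |(det2 u w)⁻¹| * ∫⁻ x in S, F x := by
  set L : Plane →ₗ[ℝ] Plane :=
    Matrix.toLin (PiLp.basisFun 2 ℝ (Fin 2)) (PiLp.basisFun 2 ℝ (Fin 2)) !![u 0, w 0; u 1, w 1]
    with hL
  have hdet : LinearMap.det L = det2 u w := by
    rw [hL, LinearMap.det_toLin, Matrix.det_fin_two_of, det2]
  have hLx : ∀ x : Plane, L x = x 0 • u + x 1 • w := by
    intro x
    rw [hL]
    ext i
    fin_cases i <;> simp [Matrix.toLin_apply, Matrix.mulVec, dotProduct, Fin.sum_univ_two] <;> ring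
  have hLm : Measurable L := L.continuous_of_finiteDimensional.measurable
  have hind : Measurable (S.indicator F) := hF.indicator hS
  have hG : Measurable fun z : ℝ × ℝ => S.indicator F (a + (z.1 • u + z.2 • w)) := by
    refine hind.comp ?_
    fun_prop
  calc ∫⁻ t in Set.Icc (0 : ℝ) 1, ∫⁻ s in Set.Icc (0 : ℝ) 1, F (a + (t • u + s • w))
      = ∫⁻ t in Set.Icc (0 : ℝ) 1, ∫⁻ s in Set.Icc (0 : ℝ) 1,
          S.indicator F (a + (t • u + s • w)) := by
        refine setLIntegral_congr_fun measurableSet_Icc fun t ht => ?_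
        refine setLIntegral_congr_fun measurableSet_Icc fun s hs => ?_
        exact (Set.indicator_of_mem (hP t ht s hs) F).symm
    _ ≤ ∫⁻ t, ∫⁻ s, S.indicator F (a + (t • u + s • w)) :=
        (setLIntegral_le_lintegral _ _).trans
          (lintegral_mono fun t => setLIntegral_le_lintegral _ _)
    _ = ∫⁻ z : ℝ × ℝ, S.indicator F (a + (z.1 • u + z.2 • w)) :=
        (lintegral_prod _ hG.aemeasurable).symm
    _ = ∫⁻ x : Plane, S.indicator F (a + L x) := by
        rw [← measurePreserving_coords.lintegral_comp hG]
        simp_rw [hLx]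
    _ = ∫⁻ y, S.indicator F (a + y) ∂(Measure.map L volume) := by
        exact (lintegral_map (hind.comp (measurable_const_add a)) hLm).symm
    _ = ENNReal.ofReal |(det2 u w)⁻¹| * ∫⁻ x in S, F x := by
        rw [Measure.map_linearMap_addHaar_eq_smul_addHaar _ (by rwa [hdet]), lintegral_smul_measure,
          hdet, smul_eq_mul, lintegral_add_left_eq_self (fun y => S.indicator F y) a,
          lintegral_indicator hS]

/-- A function that is bounded at each point of the segment `[a, a + u]` by its mean along the
translate in direction `w` is bounded in the mean by its integral over the parallelogram. -/
theorem lintegral_segment_le {F G : Plane → ℝ} (hF : Continuous F) (hG : Continuous G)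
    (hG0 : ∀ x, 0 ≤ G x) {S : Set Plane} (hS : MeasurableSet S) {a u w : Plane}
    (hd : det2 u w ≠ 0)
    (hP : ∀ t ∈ Set.Icc (0 : ℝ) 1, ∀ s ∈ Set.Icc (0 : ℝ) 1, a + (t • u + s • w) ∈ S)
    (hFG : ∀ y, F y ≤ ∫ s in (0 : ℝ)..1, G (y + s • w)) :
    ∫⁻ x in segment ℝ a (a + u), ENNReal.ofReal (F x) ∂arcLength ≤
      ENNReal.ofReal (‖u‖ * |(det2 u w)⁻¹|) * ∫⁻ x in S, ENNReal.ofReal (G x) := by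
  have hm : Measurable (AffineMap.lineMap a (a + u) : ℝ → Plane) :=
    AffineMap.lineMap_continuous.measurable
  have hFm : Measurable fun x => ENNReal.ofReal (F x) := hF.measurable.ennreal_ofReal
  have hGm : Measurable fun x => ENNReal.ofReal (G x) := hG.measurable.ennreal_ofReal
  have hn : (nndist a (a + u) : ℝ≥0∞) = ENNReal.ofReal ‖u‖ := by
    rw [← edist_nndist, edist_dist, dist_self_add_right]
  have key : ∀ y, ENNReal.ofReal (F y) ≤
      ∫⁻ s in Set.Icc (0 : ℝ) 1, ENNReal.ofReal (G (y + s • w)) := by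
    intro y
    have hc : Continuous fun s : ℝ => G (y + s • w) := hG.comp (by fun_prop)
    rw [← ofReal_integral_eq_lintegral_ofReal
      (hc.continuousOn.integrableOn_compact isCompact_Icc) (ae_of_all _ fun _ => hG0 _),
      integral_Icc_eq_integral_Ioc, ← intervalIntegral.integral_of_le zero_le_one]
    exact ENNReal.ofReal_le_ofReal (hFG y)
  rw [arcLength_restrict_segment, lintegral_smul_measure, smul_eq_mul, lintegral_map hFm hm, hn,
    ENNReal.ofReal_mul (norm_nonneg u), mul_assoc]
  gcongr
  refine le_trans (lintegral_mono fun t => ?_) (lintegral_parallelogram_le hGm hS hd hP)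
  refine (key _).trans_eq ?_
  simp only [AffineMap.lineMap_apply_module', add_sub_cancel_left]
  refine lintegral_congr fun s => ?_
  congr 2
  abel

/-! ### Trace inequalities on a triangle -/

/-- This is the fundamental theorem of calculus for `(1 - s) g(s)²`. -/
theorem sq_le_integral_of_hasDerivAt {g g' : ℝ → ℝ} (hg : ∀ s, HasDerivAt g (g' s) s)
    (hg' : Continuous g') : g 0 ^ 2 ≤ ∫ s in (0 : ℝ)..1, (2 * g s ^ 2 + g' s ^ 2) := by
  have hc : Continuous g := continuous_iff_continuousAt.2 fun s => (hg s).continuousAt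
  have hd : ∀ s : ℝ, HasDerivAt (fun s => -((1 - s) * g s ^ 2))
      (g s ^ 2 - 2 * (1 - s) * g s * g' s) s := by
    intro s
    have h := (((hasDerivAt_id s).const_sub 1).mul ((hg s).pow 2)).neg
    refine h.congr_deriv ?_
    simp
    ring
  have h := intervalIntegral.integral_eq_sub_of_hasDerivAt (a := 0) (b := 1)
    (fun s _ => hd s) ((by fun_prop : Continuous _).intervalIntegrable _ _)
  have h0 : g 0 ^ 2 = ∫ s in (0 : ℝ)..1, (g s ^ 2 - 2 * (1 - s) * g s * g' s) := by
    rw [h]; simp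
  rw [h0]
  refine intervalIntegral.integral_mono_on zero_le_one
    ((by fun_prop : Continuous _).intervalIntegrable _ _)
    ((by fun_prop : Continuous _).intervalIntegrable _ _) fun s hs => ?_
  nlinarith [sq_nonneg ((1 - s) * g s + g' s), mul_nonneg hs.1 (sub_nonneg.2 hs.2),
    mul_nonneg (mul_nonneg hs.1 (by linarith [hs.2] : 0 ≤ 2 - s)) (sq_nonneg (g s))]

/-- The constant four is the best possible one. -/
theorem sq_le_integral_affine (A B : ℝ) : A ^ 2 ≤ ∫ s in (0 : ℝ)..1, 4 * (A + s * B) ^ 2 := by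
  have h : ∀ s : ℝ, HasDerivAt (fun s : ℝ => 4 * (A ^ 2 * s + A * B * s ^ 2 + B ^ 2 * s ^ 3 / 3))
      (4 * (A + s * B) ^ 2) s := by
    intro s
    have := ((((hasDerivAt_id s).const_mul (A ^ 2)).add
      ((hasDerivAt_pow 2 s).const_mul (A * B))).add
      (((hasDerivAt_pow 3 s).const_mul (B ^ 2)).div_const 3)).const_mul 4
    refine this.congr_deriv ?_
    simp
    ring
  rw [intervalIntegral.integral_eq_sub_of_hasDerivAt (fun s _ => h s)
    ((by fun_prop : Continuous _).intervalIntegrable _ _)]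
  nlinarith [sq_nonneg (3 * A + 2 * B)]

theorem abs_det2_eq_sin_angle (u w : Plane) :
    |det2 u w| = Real.sin (InnerProductGeometry.angle u w) * (‖u‖ * ‖w‖) := by
  rw [InnerProductGeometry.sin_angle_mul_norm_mul_norm, ← Real.sqrt_sq_eq_abs]
  congr 1
  simp only [PiLp.inner_apply, Fin.sum_univ_two, det2, RCLike.inner_apply, conj_trivial]
  ring

theorem det2_sub_swap (a b c : Plane) : det2 (a - b) (c - b) = -det2 (b - a) (c - a) := by
  simp [det2]; ring

theorem sin_le_sin_of_mem {θ x : ℝ} (h0 : 0 < θ) (hx : θ ≤ x)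
    (hx' : x ≤ Real.pi - θ) : Real.sin θ ≤ Real.sin x := by
  have := Real.pi_gt_three
  rcases le_total x (Real.pi / 2) with h | h
  · exact Real.sin_le_sin_of_le_of_le_pi_div_two (by linarith) h hx
  · rw [← Real.sin_pi_sub x]
    exact Real.sin_le_sin_of_le_of_le_pi_div_two (by linarith) (by linarith) (by linarith)

/-- `a`, `b`, `c` are the vertices of a triangle all of whose angles are at least `θ`. The bound
`θ ≤ 1` is a normalization that makes `sin θ` positive; that the triangle does not degenerate
follows from the angles. -/
structure IsAdmissible (θ : ℝ) (a b c : Plane) : Prop where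
  pos : 0 < θ
  le_one : θ ≤ 1
  ne : a ≠ b
  angle₁ : θ ≤ EuclideanGeometry.angle b a c
  angle₂ : θ ≤ EuclideanGeometry.angle a b c
  angle₃ : θ ≤ EuclideanGeometry.angle b c a

/-- The diameter of the triangle with vertices `a`, `b`, `c`. -/
noncomputable def triDiam (a b c : Plane) : ℝ := Metric.diam (convexHull ℝ {a, b, c})

theorem triDiam_eq (a b c : Plane) : triDiam a b c = max (max (dist a b) (dist a c)) (dist b c) := by
  rw [triDiam, convexHull_diam, Metric.diam_triple]

namespace IsAdmissible

variable {θ : ℝ} {a b c : Plane}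

theorem sin_pos (h : IsAdmissible θ a b c) : 0 < Real.sin θ :=
  Real.sin_pos_of_pos_of_lt_pi h.pos (by linarith [h.le_one, Real.pi_gt_three])

theorem diam_pos (h : IsAdmissible θ a b c) : 0 < triDiam a b c := by
  rw [triDiam_eq]
  exact lt_max_of_lt_left (lt_max_of_lt_left (dist_pos.2 h.ne))

/-- The height over the edge `ab` is bounded from below by a multiple of the diameter. -/
theorem le_det (h : IsAdmissible θ a b c) :
    Real.sin θ * (‖b - a‖ * triDiam a b c) ≤ 2 * |det2 (b - a) (c - a)| := by
  have hsum := EuclideanGeometry.angle_add_angle_add_angle_eq_pi (p₁ := a) (p₂ := b) c h.ne.symm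
  rw [EuclideanGeometry.angle_comm c a b] at hsum
  have h1 := h.angle₁
  have h2 := h.angle₂
  have h3 := h.angle₃
  have hθ := h.pos
  have s1 := sin_le_sin_of_mem h.pos h1 (by linarith)
  have s2 := sin_le_sin_of_mem h.pos h2 (by linarith)
  have e1 := abs_det2_eq_sin_angle (b - a) (c - a)
  have e2 := abs_det2_eq_sin_angle (a - b) (c - b)
  rw [det2_sub_swap, abs_neg, norm_sub_rev a b] at e2
  change _ ≤ Real.sin (InnerProductGeometry.angle (b - a) (c - a)) at s1
  change _ ≤ Real.sin (InnerProductGeometry.angle (a - b) (c - b)) at s2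
  have hD : triDiam a b c ≤ ‖c - a‖ + ‖c - b‖ := by
    rw [triDiam_eq, ← dist_eq_norm, ← dist_eq_norm, dist_comm c a, dist_comm c b]
    refine max_le (max_le (dist_triangle_right a b c) ?_) ?_ <;>
      linarith [dist_nonneg (x := a) (y := c), dist_nonneg (x := b) (y := c)]
  have hs := h.sin_pos.le
  calc Real.sin θ * (‖b - a‖ * triDiam a b c)
      ≤ Real.sin θ * (‖b - a‖ * (‖c - a‖ + ‖c - b‖)) := by gcongr
    _ = Real.sin θ * (‖b - a‖ * ‖c - a‖) + Real.sin θ * (‖b - a‖ * ‖c - b‖) := by ring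
    _ ≤ |det2 (b - a) (c - a)| + |det2 (b - a) (c - a)| := by
        gcongr
        · rw [e1]; gcongr
        · rw [e2]; gcongr
    _ = _ := by ring

theorem det_ne_zero (h : IsAdmissible θ a b c) : det2 (b - a) (c - a) ≠ 0 := by
  have h1 := h.le_det
  have h2 : 0 < Real.sin θ * (‖b - a‖ * triDiam a b c) :=
    mul_pos h.sin_pos (mul_pos (norm_pos_iff.2 (sub_ne_zero.2 h.ne.symm)) h.diam_pos)
  intro h0
  rw [h0] at h1
  simp at h1
  linarith

theorem ratio_le (h : IsAdmissible θ a b c) :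
    4 * ‖b - a‖ * |(det2 (b - a) (c - a))⁻¹| ≤ 8 / (Real.sin θ * triDiam a b c) := by
  have h1 := h.le_det
  have h2 := abs_pos.2 h.det_ne_zero
  have h3 := mul_pos h.sin_pos h.diam_pos
  rw [abs_inv, ← div_eq_mul_inv, div_le_div_iff₀ h2 h3]
  linarith

end IsAdmissible

theorem segment_subset_union_halves (a b : Plane) :
    segment ℝ a b ⊆ segment ℝ a (a + (1 / 2 : ℝ) • (b - a)) ∪
      segment ℝ b (b + (1 / 2 : ℝ) • (a - b)) := by
  intro x hx
  rw [segment_eq_image'] at hx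
  obtain ⟨t, ht, rfl⟩ := hx
  rcases le_total t (1 / 2) with h | h
  · left
    rw [segment_eq_image']
    refine ⟨2 * t, ⟨by linarith [ht.1], by linarith⟩, ?_⟩
    simp only
    module
  · right
    rw [segment_eq_image']
    refine ⟨2 * (1 - t), ⟨by linarith [ht.2], by linarith⟩, ?_⟩
    simp only
    module

/-- The parallelogram at `a` spanned by half of each adjacent side lies in the triangle. -/
theorem parallelogram_mem_convexHull (a b c : Plane) {t s : ℝ} (ht : t ∈ Set.Icc (0 : ℝ) 1)
    (hs : s ∈ Set.Icc (0 : ℝ) 1) :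
    a + (t • ((1 / 2 : ℝ) • (b - a)) + s • ((1 / 2 : ℝ) • (c - a))) ∈
      convexHull ℝ ({a, b, c} : Set Plane) := by
  have h := (convex_convexHull ℝ ({a, b, c} : Set Plane)).sum_mem (t := Finset.univ)
    (w := ![1 - t / 2 - s / 2, t / 2, s / 2]) (z := ![a, b, c]) ?_ ?_ ?_
  · convert h using 1
    simp [Fin.sum_univ_three]
    module
  · intro i _
    fin_cases i <;> simp <;> linarith [ht.1, ht.2, hs.1, hs.2]
  · simp [Fin.sum_univ_three]
    ring
  · intro i _
    apply subset_convexHull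
    fin_cases i <;> simp

/-- The common form of both trace inequalities: if `F` is bounded at every point by the mean of `G`
along short enough translates, then its integral over an edge is bounded by that of `G` over the
triangle. Each half of the edge is translated, inside the triangle, towards the opposite vertex. -/
theorem lintegral_edge_le {θ : ℝ} {a b c : Plane} (h : IsAdmissible θ a b c) {F G : Plane → ℝ}
    (hF : Continuous F) (hG : Continuous G) (hG0 : ∀ x, 0 ≤ G x)
    (hFG : ∀ w : Plane, ‖w‖ ≤ triDiam a b c → ∀ y, F y ≤ ∫ s in (0 : ℝ)..1, G (y + s • w)) :
    ∫⁻ x in segment ℝ a b, ENNReal.ofReal (F x) ∂arcLength ≤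
      ENNReal.ofReal (8 / (Real.sin θ * triDiam a b c)) *
        ∫⁻ x in convexHull ℝ {a, b, c}, ENNReal.ofReal (G x) := by
  have hS : MeasurableSet (convexHull ℝ ({a, b, c} : Set Plane)) :=
    ((Set.toFinite _).isCompact_convexHull ℝ).measurableSet
  have hdet := h.det_ne_zero
  have hd : ∀ u w : Plane, det2 ((1 / 2 : ℝ) • u) ((1 / 2 : ℝ) • w) = det2 u w / 4 := by
    intro u w; simp [det2]; ring
  have hD := triDiam_eq a b c
  have hw1 : ‖(1 / 2 : ℝ) • (c - a)‖ ≤ triDiam a b c := by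
    have : dist a c ≤ triDiam a b c := by
      rw [hD]; exact le_max_of_le_left (le_max_right _ _)
    rw [dist_comm, dist_eq_norm] at this
    rw [norm_smul]; norm_num; linarith [norm_nonneg (c - a)]
  have hw2 : ‖(1 / 2 : ℝ) • (c - b)‖ ≤ triDiam a b c := by
    have : dist b c ≤ triDiam a b c := by
      rw [hD]; exact le_max_right _ _
    rw [dist_comm, dist_eq_norm] at this
    rw [norm_smul]; norm_num; linarith [norm_nonneg (c - b)]
  -- the two halves of the edge, translated by half of the side that starts at the same vertex
  have k1 := lintegral_segment_le hF hG hG0 hS (a := a) (u := (1 / 2 : ℝ) • (b - a))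
    (w := (1 / 2 : ℝ) • (c - a)) (by rw [hd]; exact div_ne_zero hdet (by norm_num))
    (fun t ht s hs => parallelogram_mem_convexHull a b c ht hs) (hFG _ hw1)
  have k2 := lintegral_segment_le hF hG hG0 hS (a := b) (u := (1 / 2 : ℝ) • (a - b))
    (w := (1 / 2 : ℝ) • (c - b))
    (by rw [hd, det2_sub_swap]; exact div_ne_zero (neg_ne_zero.2 hdet) (by norm_num))
    (fun t ht s hs => by
      rw [Set.insert_comm]; exact parallelogram_mem_convexHull b a c ht hs) (hFG _ hw2)
  have hr := h.ratio_le
  have e1 : ‖(1 / 2 : ℝ) • (b - a)‖ * |(det2 ((1 / 2 : ℝ) • (b - a)) ((1 / 2 : ℝ) • (c - a)))⁻¹|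
      = 2 * ‖b - a‖ * |(det2 (b - a) (c - a))⁻¹| := by
    rw [hd, norm_smul, inv_div, div_eq_mul_inv 4, abs_mul]; norm_num; ring
  have e2 : ‖(1 / 2 : ℝ) • (a - b)‖ * |(det2 ((1 / 2 : ℝ) • (a - b)) ((1 / 2 : ℝ) • (c - b)))⁻¹|
      = 2 * ‖b - a‖ * |(det2 (b - a) (c - a))⁻¹| := by
    rw [hd, det2_sub_swap, norm_smul, inv_div, div_eq_mul_inv 4, abs_mul, norm_sub_rev a b, inv_neg,
      abs_neg]
    norm_num; ring
  rw [e1] at k1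
  rw [e2] at k2
  refine (lintegral_mono_set (segment_subset_union_halves a b)).trans
    ((lintegral_union_le _ _ _).trans ((add_le_add k1 k2).trans ?_))
  rw [← add_mul, ← ENNReal.ofReal_add (by positivity) (by positivity)]
  gcongr
  linarith

/-! ### Traces of Sobolev functions -/

/-- The square of the `L²` norm, with values in `[0, ∞]`. -/
noncomputable def sqNorm (μ : Measure Plane) (f : Plane → ℝ) : ℝ≥0∞ :=
  ∫⁻ x, ENNReal.ofReal (f x ^ 2) ∂μ

theorem sqNorm_eq_eLpNorm_sq (μ : Measure Plane) (f : Plane → ℝ) :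
    sqNorm μ f = eLpNorm f 2 μ ^ 2 := by
  have h := eLpNorm_nnreal_pow_eq_lintegral (f := f) (μ := μ) (p := 2) (by norm_num)
  simp only [NNReal.coe_ofNat, ENNReal.coe_ofNat, ENNReal.rpow_ofNat] at h
  rw [h, sqNorm]
  refine lintegral_congr fun x => ?_
  rw [← sq_abs, ← Real.norm_eq_abs, ENNReal.ofReal_pow (norm_nonneg _), ofReal_norm]

theorem sqNorm_add_le {μ : Measure Plane} {f : Plane → ℝ} (hf : AEStronglyMeasurable f μ)
    (g : Plane → ℝ) : sqNorm μ (f + g) ≤ 2 * sqNorm μ f + 2 * sqNorm μ g := by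
  have hm : AEMeasurable (fun x => ENNReal.ofReal (f x ^ 2)) μ :=
    (hf.aemeasurable.pow_const 2).ennreal_ofReal
  simp only [sqNorm]
  rw [← lintegral_const_mul'' _ hm, ← lintegral_const_mul' _ _ (by norm_num),
    ← lintegral_add_left' (hm.const_mul 2)]
  refine lintegral_mono fun x => ?_
  have e : (2 : ℝ≥0∞) = ENNReal.ofReal 2 := by simp
  simp only [Pi.add_apply]
  rw [e, ← ENNReal.ofReal_mul zero_le_two, ← ENNReal.ofReal_mul zero_le_two,
    ← ENNReal.ofReal_add (by positivity) (by positivity)]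
  refine ENNReal.ofReal_le_ofReal ?_
  nlinarith [sq_nonneg (f x - g x)]

theorem sqNorm_congr {μ : Measure Plane} {f g : Plane → ℝ} (h : f =ᵐ[μ] g) :
    sqNorm μ f = sqNorm μ g := by
  refine lintegral_congr_ae ?_
  filter_upwards [h] with x hx
  rw [hx]

theorem sqNorm_sub_comm (μ : Measure Plane) (f g : Plane → ℝ) :
    sqNorm μ (f - g) = sqNorm μ (g - f) := by
  refine lintegral_congr fun x => ?_
  simp only [Pi.sub_apply]
  congr 1
  ring

theorem tendsto_sqNorm {μ : Measure Plane} {f : ℕ → Plane → ℝ}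
    (h : Tendsto (fun n => eLpNorm (f n) 2 μ) atTop (𝓝 0)) :
    Tendsto (fun n => sqNorm μ (f n)) atTop (𝓝 0) := by
  simp_rw [sqNorm_eq_eLpNorm_sq]
  simpa using ENNReal.Tendsto.pow (n := 2) h

theorem ofReal_integral_sq {μ : Measure Plane} {f : Plane → ℝ} (hf : MemLp f 2 μ) :
    ENNReal.ofReal (∫ x, f x ^ 2 ∂μ) = sqNorm μ f :=
  ofReal_integral_eq_lintegral_ofReal hf.integrable_sq (ae_of_all _ fun _ => sq_nonneg _)

theorem ae_eq_of_sqNorm_sub {μ : Measure Plane} {f g : Plane → ℝ}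
    (hf : AEStronglyMeasurable f μ) (hg : AEStronglyMeasurable g μ)
    (h : sqNorm μ (f - g) = 0) : f =ᵐ[μ] g := by
  rw [sqNorm_eq_eLpNorm_sq, pow_eq_zero_iff two_ne_zero,
    eLpNorm_eq_zero_iff (hf.sub hg) two_ne_zero] at h
  filter_upwards [h] with x hx
  exact sub_eq_zero.1 hx

theorem partialDeriv_sub {i : Fin 2} {f g : Plane → ℝ} (hf : ContDiff ℝ ∞ f)
    (hg : ContDiff ℝ ∞ g) : partialDeriv i (f - g) = partialDeriv i f - partialDeriv i g := by
  ext x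
  simp [partialDeriv, fderiv_sub (hf.differentiable (by simp) x) (hg.differentiable (by simp) x)]

theorem sq_fderiv_apply_le (φ : Plane → ℝ) (x w : Plane) :
    (fderiv ℝ φ x w) ^ 2 ≤ ‖w‖ ^ 2 * (partialDeriv 0 φ x ^ 2 + partialDeriv 1 φ x ^ 2) := by
  have hw : w = w 0 • EuclideanSpace.single 0 (1 : ℝ) + w 1 • EuclideanSpace.single 1 (1 : ℝ) := by
    ext i; fin_cases i <;> simp
  have h : fderiv ℝ φ x w = w 0 * partialDeriv 0 φ x + w 1 * partialDeriv 1 φ x := by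
    conv_lhs => rw [hw]
    simp [partialDeriv]
  rw [h, EuclideanSpace.norm_sq_eq, Fin.sum_univ_two, Real.norm_eq_abs, Real.norm_eq_abs, sq_abs,
    sq_abs]
  nlinarith [sq_nonneg (w 0 * partialDeriv 1 φ x - w 1 * partialDeriv 0 φ x)]

theorem volume_restrict_interior_convexHull (s : Set Plane) :
    volume.restrict (interior (convexHull ℝ s)) = volume.restrict (convexHull ℝ s) :=
  Measure.restrict_congr_set
    (interior_ae_eq_of_null_frontier ((convex_convexHull ℝ s).addHaar_frontier volume))

section

variable {θ : ℝ} {a b c : Plane}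

/-- The trace inequality for smooth functions. -/
theorem IsAdmissible.sqNorm_edge_le (h : IsAdmissible θ a b c) {φ : Plane → ℝ}
    (hφ : ContDiff ℝ ∞ φ) :
    sqNorm (arcLength.restrict (segment ℝ a b)) φ ≤
      ENNReal.ofReal (8 / (Real.sin θ * triDiam a b c)) *
        (2 * sqNorm (volume.restrict (interior (convexHull ℝ {a, b, c}))) φ +
          ENNReal.ofReal (triDiam a b c ^ 2) * ∑ i,
            sqNorm (volume.restrict (interior (convexHull ℝ {a, b, c}))) (partialDeriv i φ)) := by
  have hc := hφ.continuous
  have h0 := continuous_partialDeriv (i := 0) hφ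
  have h1 := continuous_partialDeriv (i := 1) hφ
  refine (lintegral_edge_le h (F := fun x => φ x ^ 2) (G := fun x => 2 * φ x ^ 2 +
    triDiam a b c ^ 2 * (partialDeriv 0 φ x ^ 2 + partialDeriv 1 φ x ^ 2)) (by fun_prop)
    (by fun_prop) (fun x => by positivity) ?_).trans_eq ?_
  · intro w hw y
    have hd : ∀ s : ℝ, HasDerivAt (fun s : ℝ => φ (y + s • w)) (fderiv ℝ φ (y + s • w) w) s := by
      intro s
      have hl : HasDerivAt (fun s : ℝ => y + s • w) w s := by
        simpa using ((hasDerivAt_id s).smul_const w).const_add y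
      exact (hφ.differentiable (by simp) _).hasFDerivAt.comp_hasDerivAt s hl
    have hl : Continuous fun s : ℝ => y + s • w := by fun_prop
    have hc' : Continuous fun s : ℝ => fderiv ℝ φ (y + s • w) w :=
      ((hφ.continuous_fderiv (by simp)).comp hl).clm_apply continuous_const
    have hcl := hc.comp hl
    have h0l := h0.comp hl
    have h1l := h1.comp hl
    simp only [Function.comp_def] at hcl h0l h1l
    have key := sq_le_integral_of_hasDerivAt hd hc'
    simp only [zero_smul, add_zero] at key
    refine key.trans (intervalIntegral.integral_mono_on zero_le_one
      ((by fun_prop : Continuous _).intervalIntegrable _ _)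
      ((by fun_prop : Continuous _).intervalIntegrable _ _) fun s _ => ?_)
    refine add_le_add le_rfl ((sq_fderiv_apply_le φ _ w).trans ?_)
    gcongr
  · have hm : Measurable fun x => ENNReal.ofReal (φ x ^ 2) := by fun_prop
    have hm0 : Measurable fun x => ENNReal.ofReal (partialDeriv 0 φ x ^ 2) := by fun_prop
    have hm1 : Measurable fun x => ENNReal.ofReal (partialDeriv 1 φ x ^ 2) := by fun_prop
    rw [volume_restrict_interior_convexHull]
    congr 1
    simp only [sqNorm, Fin.sum_univ_two]
    rw [← lintegral_add_left hm0, ← lintegral_const_mul _ (by fun_prop),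
      ← lintegral_const_mul _ (by fun_prop), ← lintegral_add_left (by fun_prop)]
    refine lintegral_congr fun x => ?_
    rw [ENNReal.ofReal_add (by positivity) (by positivity), ENNReal.ofReal_mul zero_le_two,
      ENNReal.ofReal_mul (by positivity), ENNReal.ofReal_add (by positivity) (by positivity)]
    simp

/-- The trace inequality for the difference of a Sobolev function and a smooth function. With
`ψ = 0` it bounds traces; with `ψ` equal to the function it shows that the trace of a smooth
function is its restriction. -/
theorem IsAdmissible.sqNorm_trace_sub_le (h : IsAdmissible θ a b c) {f t ψ : Plane → ℝ}
    (ht : IsTrace (interior (convexHull ℝ {a, b, c})) (segment ℝ a b) f t)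
    (hψ : ContDiff ℝ ∞ ψ) :
    sqNorm (arcLength.restrict (segment ℝ a b)) (t - ψ) ≤
      2 * (ENNReal.ofReal (8 / (Real.sin θ * triDiam a b c)) *
        (2 * (2 * sqNorm (volume.restrict (interior (convexHull ℝ {a, b, c}))) (f - ψ)) +
          ENNReal.ofReal (triDiam a b c ^ 2) * ∑ i,
            2 * sqNorm (volume.restrict (interior (convexHull ℝ {a, b, c})))
              (weakDeriv (interior (convexHull ℝ {a, b, c})) i f - partialDeriv i ψ))) := by
  -- the inequality for the smooth functions `φ n - ψ` survives the limit, at the cost of factors two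
  obtain ⟨hf, htm, φ, hφ, hφ0, hφ1, hφt⟩ := ht
  set U := interior (convexHull ℝ ({a, b, c} : Set Plane))
  set C := ENNReal.ofReal (8 / (Real.sin θ * triDiam a b c))
  set D := ENNReal.ofReal (triDiam a b c ^ 2)
  set μ := volume.restrict U
  set ν := arcLength.restrict (segment ℝ a b)
  have hfm := hf.memLp.aestronglyMeasurable
  have hwm : ∀ i, AEStronglyMeasurable (weakDeriv U i f) μ := fun i =>
    (hf.weakDeriv isOpen_interior i).memLp.aestronglyMeasurable
  have hC : C ≠ ⊤ := ENNReal.ofReal_ne_top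
  have hD : D ≠ ⊤ := ENNReal.ofReal_ne_top
  have step : ∀ n, sqNorm ν (t - ψ) ≤ 2 * sqNorm ν (φ n - t) +
      2 * (C * (2 * (2 * sqNorm μ (φ n - f) + 2 * sqNorm μ (f - ψ)) +
        D * ∑ i, (2 * sqNorm μ (partialDeriv i (φ n) - weakDeriv U i f) +
          2 * sqNorm μ (weakDeriv U i f - partialDeriv i ψ)))) := by
    intro n
    have e1 : t - ψ = (t - φ n) + (φ n - ψ) := by abel
    have e2 : φ n - ψ = (φ n - f) + (f - ψ) := by abel
    have e3 : ∀ i, partialDeriv i (φ n - ψ) =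
        (partialDeriv i (φ n) - weakDeriv U i f) + (weakDeriv U i f - partialDeriv i ψ) := by
      intro i
      rw [partialDeriv_sub (hφ n) hψ]
      abel
    rw [e1]
    refine (sqNorm_add_le (htm.aestronglyMeasurable.sub
      (hφ n).continuous.aestronglyMeasurable) _).trans ?_
    rw [sqNorm_sub_comm ν t]
    gcongr
    refine (h.sqNorm_edge_le ((hφ n).sub hψ)).trans ?_
    change C * (2 * sqNorm μ (φ n - ψ) + D * ∑ i, sqNorm μ (partialDeriv i (φ n - ψ))) ≤ _
    gcongr with i
    · rw [e2]
      exact sqNorm_add_le ((hφ n).continuous.aestronglyMeasurable.sub hfm) _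
    · rw [e3]
      exact sqNorm_add_le
        ((continuous_partialDeriv (hφ n)).aestronglyMeasurable.sub (hwm i)) _
  refine ge_of_tendsto' (x := atTop) (f := fun n => 2 * sqNorm ν (φ n - t) +
      2 * (C * (2 * (2 * sqNorm μ (φ n - f) + 2 * sqNorm μ (f - ψ)) +
        D * ∑ i, (2 * sqNorm μ (partialDeriv i (φ n) - weakDeriv U i f) +
          2 * sqNorm μ (weakDeriv U i f - partialDeriv i ψ))))) ?_ step
  have two : (2 : ℝ≥0∞) ≠ ⊤ := by norm_num
  have l0 := ENNReal.Tendsto.const_mul (tendsto_sqNorm hφt) (Or.inr two)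
  have l1 := (ENNReal.Tendsto.const_mul (tendsto_sqNorm hφ0) (Or.inr two)).add_const
    (2 * sqNorm μ (f - ψ))
  have l2 := tendsto_finsetSum Finset.univ fun i (_ : i ∈ Finset.univ) =>
    (ENNReal.Tendsto.const_mul (tendsto_sqNorm (hφ1 i)) (Or.inr two)).add_const
      (2 * sqNorm μ (weakDeriv U i f - partialDeriv i ψ))
  have l3 := l0.add (ENNReal.Tendsto.const_mul (ENNReal.Tendsto.const_mul
    ((ENNReal.Tendsto.const_mul l1 (Or.inr two)).add
      (ENNReal.Tendsto.const_mul l2 (Or.inr hD))) (Or.inr hC)) (Or.inr two))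
  simpa using l3

end

theorem memLp_trace (U S : Set Plane) (f : Plane → ℝ) :
    MemLp (trace U S f) 2 (arcLength.restrict S) := by
  unfold trace
  split_ifs with h
  · exact h.choose_spec.2.1
  · exact MemLp.zero'

theorem isTrace_trace {U S : Set Plane} {f : Plane → ℝ} (h : ∃ t, IsTrace U S f t) :
    IsTrace U S f (trace U S f) := by
  rw [trace, dif_pos h]
  exact h.choose_spec

theorem trace_of_not_exists {U S : Set Plane} {f : Plane → ℝ} (h : ¬ ∃ t, IsTrace U S f t) :
    trace U S f = 0 := by
  rw [trace, dif_neg h]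

/-- `e` is an edge of the triangle `K`, all of whose angles are at least `θ`. Only the hulls of the
two vertex sets enter. -/
def IsEdgeOf (θ : ℝ) (e K : Finset Plane) : Prop :=
  ∃ a b c, hull e = segment ℝ a b ∧ hull K = convexHull ℝ {a, b, c} ∧ IsAdmissible θ a b c

theorem IsEdgeOf.size_pos {θ : ℝ} {e K : Finset Plane} (h : IsEdgeOf θ e K) : 0 < size e := by
  obtain ⟨a, b, c, he, -, h⟩ := h
  rw [size, he, ← convexHull_pair, convexHull_diam, Metric.diam_pair]
  exact dist_pos.2 h.ne

theorem IsEdgeOf.size_le {θ : ℝ} {e K : Finset Plane} (h : IsEdgeOf θ e K) :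
    size e ≤ size K := by
  obtain ⟨a, b, c, he, hK, h⟩ := h
  rw [size, size, he, hK, ← convexHull_pair, convexHull_diam, convexHull_diam]
  exact Metric.diam_mono (by intro x; simp; tauto) (Set.toFinite _).isBounded

theorem IsEdgeOf.sin_pos {θ : ℝ} {e K : Finset Plane} (h : IsEdgeOf θ e K) : 0 < Real.sin θ := by
  obtain ⟨a, b, c, -, -, h⟩ := h
  exact h.sin_pos

/-- The trace inequality, scaled to an edge of the mesh. Where no trace exists the junk value
zero satisfies it as well. -/
theorem IsEdgeOf.integral_trace_sq_le {θ : ℝ} {e K : Finset Plane} (h : IsEdgeOf θ e K)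
    (f : Plane → ℝ) :
    size e * ∫ x in hull e, trace (cell K) (hull e) f x ^ 2 ∂arcLength ≤
      64 / Real.sin θ * ((∫ x in cell K, f x ^ 2) +
        size K ^ 2 * ∑ i, ∫ x in cell K, weakDeriv (cell K) i f x ^ 2) := by
  have hs := h.sin_pos
  have hR : 0 ≤ (∫ x in cell K, f x ^ 2) +
      size K ^ 2 * ∑ i, ∫ x in cell K, weakDeriv (cell K) i f x ^ 2 := by
    have h1 : 0 ≤ ∫ x in cell K, f x ^ 2 := integral_nonneg fun _ => sq_nonneg _
    have h2 : 0 ≤ ∑ i, ∫ x in cell K, weakDeriv (cell K) i f x ^ 2 :=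
      Finset.sum_nonneg fun _ _ => integral_nonneg fun _ => sq_nonneg _
    positivity
  by_cases ht : ∃ t, IsTrace (cell K) (hull e) f t
  swap
  · rw [trace_of_not_exists ht]
    simp only [Pi.zero_apply, ne_eq, OfNat.ofNat_ne_zero, not_false_eq_true, zero_pow,
      integral_zero, mul_zero]
    positivity
  have htr := isTrace_trace ht
  have hle := h.size_le
  have hpos := h.size_pos
  obtain ⟨a, b, c, he, hK, h⟩ := h
  have hf := htr.1
  have hcell : cell K = interior (convexHull ℝ {a, b, c}) := by rw [cell, hK]
  have key := h.sqNorm_trace_sub_le (ψ := 0) (by rwa [← hcell, ← he]) contDiff_const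
  rw [← hcell, ← he] at key
  have hz : ∀ i, partialDeriv i (0 : Plane → ℝ) = 0 := by
    intro i; ext x; simp [partialDeriv]
  simp only [hz, sub_zero] at key
  rw [← ofReal_integral_sq (memLp_trace _ _ _), ← ofReal_integral_sq hf.memLp] at key
  simp_rw [← ofReal_integral_sq ((hf.weakDeriv (isOpen_cell K) _).memLp)] at key
  have hd : triDiam a b c = size K := by rw [size, hK, triDiam]
  rw [hd] at key
  have two : (2 : ℝ≥0∞) = ENNReal.ofReal 2 := by simp
  have n0 : 0 ≤ ∫ x in cell K, f x ^ 2 := integral_nonneg fun _ => sq_nonneg _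
  have n1 : ∀ i, 0 ≤ ∫ x in cell K, weakDeriv (cell K) i f x ^ 2 := fun i =>
    integral_nonneg fun _ => sq_nonneg _
  have n2 : 0 ≤ ∑ i, 2 * ∫ x in cell K, weakDeriv (cell K) i f x ^ 2 :=
    Finset.sum_nonneg fun i _ => mul_nonneg zero_le_two (n1 i)
  have hKpos : 0 < size K := hpos.trans_le hle
  have p1 : 0 ≤ 8 / (Real.sin θ * size K) := by positivity
  simp only [two, ← ENNReal.ofReal_mul zero_le_two] at key
  rw [← ENNReal.ofReal_sum_of_nonneg fun i _ => mul_nonneg zero_le_two (n1 i),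
    ← ENNReal.ofReal_mul (by positivity), ← ENNReal.ofReal_add (by positivity) (by positivity),
    ← ENNReal.ofReal_mul p1, ← ENNReal.ofReal_mul zero_le_two,
    ENNReal.ofReal_le_ofReal_iff (by positivity), ← Finset.mul_sum] at key
  have n3 : 0 ≤ ∑ i, ∫ x in cell K, weakDeriv (cell K) i f x ^ 2 :=
    Finset.sum_nonneg fun i _ => n1 i
  have nt : 0 ≤ ∫ x in hull e, trace (cell K) (hull e) f x ^ 2 ∂arcLength :=
    integral_nonneg fun _ => sq_nonneg _
  set X := ∫ x in cell K, f x ^ 2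
  set Y := ∑ i, ∫ x in cell K, weakDeriv (cell K) i f x ^ 2
  calc size e * ∫ x in hull e, trace (cell K) (hull e) f x ^ 2 ∂arcLength
      ≤ size K * (2 * (8 / (Real.sin θ * size K) * (2 * (2 * X) + size K ^ 2 * (2 * Y)))) := by
        gcongr
    _ = 64 / Real.sin θ * X + 32 / Real.sin θ * (size K ^ 2 * Y) := by
        field_simp
        ring
    _ ≤ 64 / Real.sin θ * X + 64 / Real.sin θ * (size K ^ 2 * Y) := by
        gcongr
        norm_num
    _ = _ := by ring

/-- A polynomial of total degree at most one is an affine function. -/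
theorem exists_eval_eq_affine {p : MvPolynomial (Fin 2) ℝ} (hp : p.totalDegree ≤ 1) :
    ∃ c₀ c₁ c₂ : ℝ, ∀ x : Fin 2 → ℝ, MvPolynomial.eval x p = c₀ + (c₁ * x 0 + c₂ * x 1) := by
  have h : ∀ s ⊆ p.support, ∃ c₀ c₁ c₂ : ℝ, ∀ x : Fin 2 → ℝ,
      ∑ d ∈ s, p.coeff d * ∏ i, x i ^ d i = c₀ + (c₁ * x 0 + c₂ * x 1) := by
    intro s
    induction s using Finset.induction_on with
    | empty => exact fun _ => ⟨0, 0, 0, by simp⟩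
    | insert d s hd ih =>
      intro hs
      obtain ⟨c₀, c₁, c₂, hc⟩ := ih ((Finset.subset_insert d s).trans hs)
      have hdeg : d 0 + d 1 ≤ 1 := by
        have := (MvPolynomial.le_totalDegree (hs (Finset.mem_insert_self d s))).trans hp
        rwa [Finsupp.sum_fintype _ _ (by simp), Fin.sum_univ_two] at this
      have hcases : (d 0 = 0 ∧ d 1 = 0) ∨ (d 0 = 1 ∧ d 1 = 0) ∨ (d 0 = 0 ∧ d 1 = 1) := by omega
      rcases hcases with ⟨h0, h1⟩ | ⟨h0, h1⟩ | ⟨h0, h1⟩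
      · refine ⟨p.coeff d + c₀, c₁, c₂, fun x => ?_⟩
        rw [Finset.sum_insert hd, hc, Fin.prod_univ_two, h0, h1]; ring
      · refine ⟨c₀, p.coeff d + c₁, c₂, fun x => ?_⟩
        rw [Finset.sum_insert hd, hc, Fin.prod_univ_two, h0, h1]; ring
      · refine ⟨c₀, c₁, p.coeff d + c₂, fun x => ?_⟩
        rw [Finset.sum_insert hd, hc, Fin.prod_univ_two, h0, h1]; ring
  obtain ⟨c₀, c₁, c₂, hc⟩ := h p.support subset_rfl
  exact ⟨c₀, c₁, c₂, fun x => by rw [MvPolynomial.eval_eq', hc]⟩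

/-- The discrete trace inequality: on polynomials of degree at most one the gradient can be
dropped from the right hand side of the trace inequality. -/
theorem IsEdgeOf.integral_trace_sq_le_of_isPolyOn {θ : ℝ} {e K : Finset Plane}
    (h : IsEdgeOf θ e K) {f : Plane → ℝ} (hf : IsPolyOn 1 (cell K) f) :
    size e * ∫ x in hull e, trace (cell K) (hull e) f x ^ 2 ∂arcLength ≤
      64 / Real.sin θ * ∫ x in cell K, f x ^ 2 := by
  have hs := h.sin_pos
  have n0 : 0 ≤ ∫ x in cell K, f x ^ 2 := integral_nonneg fun _ => sq_nonneg _
  by_cases ht : ∃ t, IsTrace (cell K) (hull e) f t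
  swap
  · rw [trace_of_not_exists ht]
    simp only [Pi.zero_apply, ne_eq, OfNat.ofNat_ne_zero, not_false_eq_true, zero_pow,
      integral_zero, mul_zero]
    positivity
  have htr := isTrace_trace ht
  have hle := h.size_le
  have hpos := h.size_pos
  obtain ⟨a, b, c, he, hK, h⟩ := h
  obtain ⟨p, hp, hfp⟩ := hf
  set P : Plane → ℝ := fun x => MvPolynomial.eval (fun k => x k) p with hP
  have hPs : ContDiff ℝ ∞ P := contDiff_eval p
  have hcell : cell K = interior (convexHull ℝ {a, b, c}) := by rw [cell, hK]
  have hfP : f =ᵐ[volume.restrict (cell K)] P := hfp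
  -- the trace of the polynomial is its restriction to the edge
  have htP : trace (cell K) (hull e) f =ᵐ[arcLength.restrict (hull e)] P := by
    refine ae_eq_of_sqNorm_sub (memLp_trace _ _ _).aestronglyMeasurable
      hPs.continuous.aestronglyMeasurable ?_
    have key := h.sqNorm_trace_sub_le (ψ := P) (by rwa [← hcell, ← he]) hPs
    rw [← hcell, ← he] at key
    have z : sqNorm (volume.restrict (cell K)) 0 = 0 := by simp [sqNorm]
    have z0 : sqNorm (volume.restrict (cell K)) (f - P) = 0 := by
      rw [← z]
      refine sqNorm_congr ?_
      filter_upwards [hfP] with x hx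
      simp [hx]
    have z1 : ∀ i, sqNorm (volume.restrict (cell K))
        (weakDeriv (cell K) i f - partialDeriv i P) = 0 := by
      intro i
      rw [← z]
      refine sqNorm_congr ?_
      filter_upwards [weakDeriv_ae_eq_partialDeriv (isOpen_cell K) i hPs hfP] with x hx
      simp [hx]
    simpa [z0, z1] using key
  have hint : ∫ x in hull e, trace (cell K) (hull e) f x ^ 2 ∂arcLength =
      ∫ x in hull e, P x ^ 2 ∂arcLength := by
    refine integral_congr_ae ?_
    filter_upwards [htP] with x hx
    rw [hx]
  have hint' : ∫ x in cell K, f x ^ 2 = ∫ x in cell K, P x ^ 2 := by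
    refine integral_congr_ae ?_
    filter_upwards [hfP] with x hx
    rw [hx]
  have hPe : MemLp P 2 (arcLength.restrict (hull e)) := (memLp_trace _ _ _).ae_eq htP
  have hPK : MemLp P 2 (volume.restrict (cell K)) :=
    memLp_two_of_continuous_of_isBounded (isBounded_cell K) hPs.continuous
  obtain ⟨c₀, c₁, c₂, hc⟩ := exists_eval_eq_affine hp
  have key := lintegral_edge_le h (F := fun x => P x ^ 2) (G := fun x => 4 * P x ^ 2)
    (hPs.continuous.pow 2) (continuous_const.mul (hPs.continuous.pow 2))
    (fun x => by positivity) (by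
      intro w _ y
      have e0 : P y = c₀ + (c₁ * y 0 + c₂ * y 1) := hc _
      have e1 : ∀ s : ℝ, P (y + s • w) = P y + s * (c₁ * w 0 + c₂ * w 1) := by
        intro s
        rw [e0, hP]
        simp only [hc, PiLp.add_apply, PiLp.smul_apply, smul_eq_mul]
        ring
      simp_rw [e1]
      exact sq_le_integral_affine _ _)
  rw [← he, ← volume_restrict_interior_convexHull, ← hcell] at key
  have hd : triDiam a b c = size K := by rw [size, hK, triDiam]
  have hKpos : 0 < size K := hpos.trans_le hle
  have p1 : 0 ≤ 8 / (Real.sin θ * size K) := by positivity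
  rw [hd, ← ofReal_integral_eq_lintegral_ofReal hPe.integrable_sq
      (ae_of_all _ fun _ => sq_nonneg _),
    ← ofReal_integral_eq_lintegral_ofReal (hPK.integrable_sq.const_mul 4)
      (ae_of_all _ fun _ => by positivity), ← ENNReal.ofReal_mul p1, integral_const_mul] at key
  have n1 : 0 ≤ ∫ x in cell K, P x ^ 2 := integral_nonneg fun _ => sq_nonneg _
  rw [ENNReal.ofReal_le_ofReal_iff (by positivity)] at key
  rw [hint, hint']
  have n2 : 0 ≤ ∫ x in hull e, P x ^ 2 ∂arcLength := integral_nonneg fun _ => sq_nonneg _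
  calc size e * ∫ x in hull e, P x ^ 2 ∂arcLength
      ≤ size K * (8 / (Real.sin θ * size K) * (4 * ∫ x in cell K, P x ^ 2)) := by gcongr
    _ = 32 / Real.sin θ * ∫ x in cell K, P x ^ 2 := by field_simp; ring
    _ ≤ 64 / Real.sin θ * ∫ x in cell K, P x ^ 2 := by gcongr; norm_num

/-! ### Square integrable matrix fields -/

/-- The matrix field `F` is square integrable. -/
def MatL2 (μ : Measure Plane) (F : Plane → Mat) : Prop :=
  ∀ i j, MemLp (fun x => F x i j) 2 μ

theorem ddot_self_nonneg (A : Mat) : 0 ≤ ddot A A :=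
  Finset.sum_nonneg fun _ _ => Finset.sum_nonneg fun _ _ => mul_self_nonneg _

theorem integral_ddot_self_nonneg (μ : Measure Plane) (F : Plane → Mat) :
    0 ≤ ∫ x, ddot (F x) (F x) ∂μ :=
  integral_nonneg fun _ => ddot_self_nonneg _

theorem ddot_elastic (κ : ℝ) (A B : Mat) :
    ddot A (Triangulation.elastic κ B) = (1 - κ) * ddot A B + κ * (A.trace * B.trace) := by
  simp [ddot, Triangulation.elastic, Matrix.trace, Fin.sum_univ_two]
  ring

theorem ddot_elastic_self_le {κ : ℝ} (h0 : 0 < κ) (h1 : κ < 1 / 2) (A : Mat) :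
    ddot (Triangulation.elastic κ A) (Triangulation.elastic κ A) ≤ 4 * ddot A A := by
  have key : ddot (Triangulation.elastic κ A) (Triangulation.elastic κ A) =
      (1 - κ) ^ 2 * ddot A A + 2 * κ * (A 0 0 + A 1 1) ^ 2 := by
    simp [ddot, Triangulation.elastic, Matrix.trace, Fin.sum_univ_two]
    ring
  have h2 : (A 0 0 + A 1 1) ^ 2 ≤ 2 * ddot A A := by
    simp only [ddot, Fin.sum_univ_two]
    nlinarith [sq_nonneg (A 0 0 - A 1 1), sq_nonneg (A 0 1), sq_nonneg (A 1 0)]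
  rw [key]
  nlinarith [mul_le_mul_of_nonneg_left h2 h0.le, ddot_self_nonneg A,
    mul_nonneg (ddot_self_nonneg A) (by nlinarith : 0 ≤ 3 - 2 * κ - κ ^ 2)]

namespace MatL2

variable {μ : Measure Plane} {F G : Plane → Mat}

theorem add (hF : MatL2 μ F) (hG : MatL2 μ G) : MatL2 μ (fun x => F x + G x) :=
  fun i j => (hF i j).add (hG i j)

theorem const_smul (hF : MatL2 μ F) (c : ℝ) : MatL2 μ (fun x => c • F x) :=
  fun i j => (hF i j).const_mul c

theorem sum {ι : Type*} (s : Finset ι) {F : ι → Plane → Mat} (hF : ∀ k ∈ s, MatL2 μ (F k)) :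
    MatL2 μ (fun x => ∑ k ∈ s, F k x) := by
  intro i j
  simp only [Matrix.sum_apply]
  exact memLp_finsetSum s fun k hk => hF k hk i j

theorem elastic (hF : MatL2 μ F) (κ : ℝ) : MatL2 μ (fun x => Triangulation.elastic κ (F x)) := by
  intro i j
  have ht : MemLp (fun x => (F x).trace) 2 μ := by
    simp only [Matrix.trace, Fin.sum_univ_two, Matrix.diag_apply]
    exact (hF 0 0).add (hF 1 1)
  exact ((hF i j).const_mul (1 - κ)).add ((ht.const_mul κ).mul_const ((1 : Mat) i j))

theorem integrable_ddot (hF : MatL2 μ F) (hG : MatL2 μ G) :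
    Integrable (fun x => ddot (F x) (G x)) μ :=
  integrable_finsetSum _ fun i _ => integrable_finsetSum _ fun j _ =>
    (hF i j).integrable_mul (hG i j)

theorem integral_ddot_self (hF : MatL2 μ F) :
    ∫ x, ddot (F x) (F x) ∂μ = ∑ i, ∑ j, ∫ x, F x i j ^ 2 ∂μ := by
  simp only [ddot, ← sq]
  rw [integral_finsetSum _ fun i _ => integrable_finsetSum _ fun j _ => (hF i j).integrable_sq]
  refine Finset.sum_congr rfl fun i _ => ?_
  rw [integral_finsetSum _ fun j _ => (hF i j).integrable_sq]

theorem abs_integral_ddot_le (hF : MatL2 μ F) (hG : MatL2 μ G) :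
    |∫ x, ddot (F x) (G x) ∂μ| ≤
      √(∫ x, ddot (F x) (F x) ∂μ) * √(∫ x, ddot (G x) (G x) ∂μ) := by
  -- the quadratic polynomial `s ↦ ‖s F + G‖²` is nonnegative
  have hq : ∀ s : ℝ, 0 ≤ (∫ x, ddot (F x) (F x) ∂μ) * (s * s) +
      (2 * ∫ x, ddot (F x) (G x) ∂μ) * s + ∫ x, ddot (G x) (G x) ∂μ := by
    intro s
    have h := integral_ddot_self_nonneg μ fun x => s • F x + G x
    have e : ∀ x, ddot (s • F x + G x) (s • F x + G x) =
        (s * s) * ddot (F x) (F x) + (2 * s) * ddot (F x) (G x) + ddot (G x) (G x) := by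
      intro x
      simp [ddot, Fin.sum_univ_two]
      ring
    simp_rw [e] at h
    have hi : Integrable (fun x => (s * s) * ddot (F x) (F x) + (2 * s) * ddot (F x) (G x)) μ :=
      ((hF.integrable_ddot hF).const_mul _).add ((hF.integrable_ddot hG).const_mul _)
    rw [integral_add hi (hG.integrable_ddot hG), integral_add ((hF.integrable_ddot hF).const_mul _)
      ((hF.integrable_ddot hG).const_mul _), integral_const_mul, integral_const_mul] at h
    linarith
  have hd := discrim_le_zero hq
  rw [← Real.sqrt_mul (integral_ddot_self_nonneg μ F)]
  refine Real.abs_le_sqrt ?_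
  rw [discrim] at hd
  linarith

theorem abs_integral_ddot_elastic_le (hF : MatL2 μ F) (hG : MatL2 μ G) {κ : ℝ} (h0 : 0 < κ)
    (h1 : κ < 1 / 2) : |∫ x, ddot (F x) (Triangulation.elastic κ (G x)) ∂μ| ≤
      2 * (√(∫ x, ddot (F x) (F x) ∂μ) * √(∫ x, ddot (G x) (G x) ∂μ)) := by
  refine (hF.abs_integral_ddot_le (hG.elastic κ)).trans ?_
  have h : ∫ x, ddot (Triangulation.elastic κ (G x)) (Triangulation.elastic κ (G x)) ∂μ ≤
      2 ^ 2 * ∫ x, ddot (G x) (G x) ∂μ := by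
    rw [← integral_const_mul]
    refine integral_mono ((hG.elastic κ).integrable_ddot (hG.elastic κ))
      ((hG.integrable_ddot hG).const_mul _) fun x => ?_
    have := ddot_elastic_self_le h0 h1 (G x)
    norm_num
    exact this
  have h' := Real.sqrt_le_sqrt h
  rw [Real.sqrt_mul (by norm_num), Real.sqrt_sq zero_le_two] at h'
  calc _ ≤ √(∫ x, ddot (F x) (F x) ∂μ) * (2 * √(∫ x, ddot (G x) (G x) ∂μ)) := by gcongr
    _ = _ := by ring

end MatL2

/-- The Cauchy-Schwarz inequality for sums, with weights that are inverse to each other. -/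
theorem sum_sqrt_mul_sqrt_le_weighted {ι : Type*} (s : Finset ι) {h a b : ι → ℝ}
    (hh : ∀ i ∈ s, 0 < h i) (ha : ∀ i, 0 ≤ a i) (hb : ∀ i, 0 ≤ b i) :
    ∑ i ∈ s, √(a i) * √(b i) ≤ √(∑ i ∈ s, (h i)⁻¹ * a i) * √(∑ i ∈ s, h i * b i) := by
  have e : ∀ i ∈ s, √(a i) * √(b i) = √((h i)⁻¹ * a i) * √(h i * b i) := by
    intro i hi
    have := hh i hi
    rw [← Real.sqrt_mul (ha i), ← Real.sqrt_mul (mul_nonneg (inv_nonneg.2 this.le) (ha i))]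
    congr 1
    field_simp
  rw [Finset.sum_congr rfl e]
  refine (Real.sum_mul_le_sqrt_mul_sqrt _ _ _).trans_eq ?_
  congr 2 <;> refine Finset.sum_congr rfl fun i hi => Real.sq_sqrt ?_
  · exact mul_nonneg (inv_nonneg.2 (hh i hi).le) (ha i)
  · exact mul_nonneg (hh i hi).le (hb i)

namespace Triangulation

variable {Ω : Set Plane} {T : Triangulation Ω}

/-! ### Edges and elements -/

theorem mem_adjacent {e K : Finset Plane} : K ∈ T.adjacent e ↔ K ∈ T.elements ∧ e ⊆ K := by
  simp [adjacent]

theorem card_of_mem_elements {K : Finset Plane} (hK : K ∈ T.elements) : K.card = 3 := by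
  simp only [elements, Finset.mem_filter] at hK
  exact hK.2

theorem mem_edges {e : Finset Plane} (he : e ∈ T.edges) :
    e.card = 2 ∧ ∃ K, K ∈ T.adjacent e := by
  simp only [edges, Finset.mem_filter] at he
  obtain ⟨-, h2, K, hK, hs⟩ := he
  exact ⟨h2, K, mem_adjacent.2 ⟨hK, hs⟩⟩

theorem edges₀_subset (Γ₂ Γ₃ : Set Plane) : T.edges₀ Γ₂ Γ₃ ⊆ T.edges := by
  classical
  exact Finset.filter_subset _ _

theorem isEdgeOf {θ₀ : ℝ} (hθ : 0 < θ₀) (hT : T.MinAngle θ₀) {e K : Finset Plane}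
    (he : e ∈ T.edges) (hK : K ∈ T.adjacent e) : IsEdgeOf (min θ₀ 1) e K := by
  classical
  obtain ⟨hKe, hs⟩ := mem_adjacent.1 hK
  have h3 := card_of_mem_elements hKe
  have h2 := (mem_edges he).1
  obtain ⟨a, b, hab, rfl⟩ := Finset.card_eq_two.1 h2
  have h1 : (K \ {a, b}).card = 1 := by
    rw [Finset.card_sdiff_of_subset hs, h3, h2]
  obtain ⟨c, hc⟩ := Finset.card_eq_one.1 h1
  have hcK : c ∈ K \ {a, b} := by rw [hc]; simp
  obtain ⟨hcK, hcn⟩ := Finset.mem_sdiff.1 hcK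
  have ha : a ∈ K := hs (by simp)
  have hb : b ∈ K := hs (by simp)
  have hac : a ≠ c := by rintro rfl; simp at hcn
  have hbc : b ≠ c := by rintro rfl; simp at hcn
  have hKeq : K = {a, b, c} := by
    rw [← Finset.sdiff_union_of_subset hs, hc]
    ext x; simp; tauto
  have hmin := min_le_left θ₀ 1
  refine ⟨a, b, c, ?_, ?_, lt_min hθ one_pos, min_le_right _ _, hab,
    hmin.trans (hT K hKe b hb a ha c hcK hab.symm hac hbc),
    hmin.trans (hT K hKe a ha b hb c hcK hab hbc hac),
    hmin.trans (hT K hKe b hb c hcK a ha hbc hac.symm hab.symm)⟩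
  · rw [hull, Finset.coe_pair, convexHull_pair]
  · rw [hull, hKeq]
    simp

/-- A triangle has at most three edges. -/
theorem sum_edges_sum_adjacent_le {E : Finset (Finset Plane)} (hE : E ⊆ T.edges)
    {g : Finset Plane → ℝ} (hg : ∀ K, 0 ≤ g K) :
    ∑ e ∈ E, ∑ K ∈ T.adjacent e, g K ≤ 3 * ∑ K ∈ T.elements, g K := by
  classical
  rw [Finset.sum_comm' (t' := T.elements) (s' := fun K => E.filter fun e => e ⊆ K)
    (by intro e K; simp only [mem_adjacent, Finset.mem_filter]; tauto), Finset.mul_sum]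
  refine Finset.sum_le_sum fun K hK => ?_
  rw [Finset.sum_const, nsmul_eq_mul]
  have hsub : (E.filter fun e => e ⊆ K) ⊆ K.powersetCard 2 := by
    intro e he
    obtain ⟨heE, hes⟩ := Finset.mem_filter.1 he
    exact Finset.mem_powersetCard.2 ⟨hes, (mem_edges (hE heE)).1⟩
  have hcard := Finset.card_le_card hsub
  rw [Finset.card_powersetCard, card_of_mem_elements hK] at hcard
  have : ((E.filter fun e => e ⊆ K).card : ℝ) ≤ 3 := by exact_mod_cast hcard
  exact mul_le_mul_of_nonneg_right this (hg K)

/-! ### Jumps and averages -/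

theorem matL2_jump (v : Plane → ℝ) (e : Finset Plane) :
    MatL2 (arcLength.restrict (hull e)) (T.jump v e) := by
  refine MatL2.sum (T.adjacent e) fun K _ => ?_
  refine MatL2.const_smul (MatL2.add ?_ ?_) _ <;> intro i j
  · exact (memLp_trace (cell K) (hull e) (weakDeriv (cell K) i v)).mul_const (outerNormal K e j)
  · exact (memLp_trace (cell K) (hull e) (weakDeriv (cell K) j v)).const_mul (outerNormal K e i)

theorem matL2_matTrace (U S : Set Plane) (τ : Plane → Mat) :
    MatL2 (arcLength.restrict S) (matTrace U S τ) :=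
  fun i j => memLp_trace U S fun y => τ y i j

theorem matL2_average (τ : Finset Plane → Plane → Mat) (e : Finset Plane) :
    MatL2 (arcLength.restrict (hull e)) (T.average τ e) :=
  (MatL2.sum (T.adjacent e) fun K _ => matL2_matTrace (cell K) (hull e) (τ K)).const_smul _

/-- Jensen's inequality for the square; over the empty set both sides vanish. -/
theorem sq_average_le {ι : Type*} (s : Finset ι) (f : ι → ℝ) :
    ((s.card : ℝ)⁻¹ * ∑ k ∈ s, f k) ^ 2 ≤ ∑ k ∈ s, f k ^ 2 := by
  rcases s.eq_empty_or_nonempty with rfl | hs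
  · simp
  have hc : (1 : ℝ) ≤ s.card := by exact_mod_cast hs.card_pos
  have h := sq_sum_le_card_mul_sum_sq (s := s) (f := f)
  have h0 : 0 ≤ ∑ k ∈ s, f k ^ 2 := Finset.sum_nonneg fun _ _ => sq_nonneg _
  rw [mul_pow, inv_pow, inv_mul_le_iff₀ (by positivity)]
  nlinarith

theorem integral_average_le (τ : Finset Plane → Plane → Mat) (e : Finset Plane) :
    ∫ x in hull e, ddot (T.average τ e x) (T.average τ e x) ∂arcLength ≤
      ∑ K ∈ T.adjacent e, ∑ i, ∑ j,
        ∫ x in hull e, trace (cell K) (hull e) (fun y => τ K y i j) x ^ 2 ∂arcLength := by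
  have hswap : ∀ f : Finset Plane → Fin 2 → Fin 2 → ℝ,
      ∑ K ∈ T.adjacent e, ∑ i, ∑ j, f K i j = ∑ i, ∑ j, ∑ K ∈ T.adjacent e, f K i j := by
    intro f
    rw [Finset.sum_comm]
    exact Finset.sum_congr rfl fun i _ => Finset.sum_comm
  rw [(matL2_average τ e).integral_ddot_self, hswap]
  refine Finset.sum_le_sum fun i _ => Finset.sum_le_sum fun j _ => ?_
  have hi : ∀ K ∈ T.adjacent e, Integrable
      (fun x => trace (cell K) (hull e) (fun y => τ K y i j) x ^ 2)
      (arcLength.restrict (hull e)) := fun K _ => (memLp_trace _ _ _).integrable_sq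
  rw [← integral_finsetSum _ hi]
  refine integral_mono (matL2_average τ e i j).integrable_sq (integrable_finsetSum _ hi)
    fun x => ?_
  refine le_trans (le_of_eq ?_)
    (sq_average_le (T.adjacent e) fun K => trace (cell K) (hull e) (fun y => τ K y i j) x)
  simp [average, matTrace, Matrix.sum_apply]

/-- If the traces of the entries of `τ` are bounded elementwise by `g`, then so is the average on
all the edges of a set `E`. -/
theorem sum_size_mul_integral_average_le {E : Finset (Finset Plane)} (hE : E ⊆ T.edges)
    (τ : Finset Plane → Plane → Mat) {g : Finset Plane → Fin 2 → Fin 2 → ℝ}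
    (hg : ∀ K i j, 0 ≤ g K i j)
    (h : ∀ e ∈ E, ∀ K ∈ T.adjacent e, ∀ i j, size e *
      ∫ x in hull e, trace (cell K) (hull e) (fun y => τ K y i j) x ^ 2 ∂arcLength ≤ g K i j) :
    ∑ e ∈ E, size e * ∫ x in hull e, ddot (T.average τ e x) (T.average τ e x) ∂arcLength ≤
      3 * ∑ K ∈ T.elements, ∑ i, ∑ j, g K i j := by
  refine le_trans (Finset.sum_le_sum fun e he => ?_)
    (sum_edges_sum_adjacent_le hE fun K => Finset.sum_nonneg fun i _ =>
      Finset.sum_nonneg fun j _ => hg K i j)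
  refine (mul_le_mul_of_nonneg_left (integral_average_le τ e) Metric.diam_nonneg).trans ?_
  simp only [Finset.mul_sum]
  exact Finset.sum_le_sum fun K hK => Finset.sum_le_sum fun i _ =>
    Finset.sum_le_sum fun j _ => h e he K hK i j

/-! ### The Cauchy-Schwarz inequality on the mesh and the liftings -/

variable {θ : ℝ}

theorem abs_sum_integral_ddot_elastic_le {ι : Type*} (s : Finset ι) {μ : ι → Measure Plane}
    {F G : ι → Plane → Mat} (hF : ∀ i ∈ s, MatL2 (μ i) (F i)) (hG : ∀ i ∈ s, MatL2 (μ i) (G i))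
    {κ : ℝ} (h0 : 0 < κ) (h1 : κ < 1 / 2) {h : ι → ℝ} (hh : ∀ i ∈ s, 0 < h i) :
    |∑ i ∈ s, ∫ x, ddot (F i x) (elastic κ (G i x)) ∂μ i| ≤
      2 * (√(∑ i ∈ s, (h i)⁻¹ * ∫ x, ddot (F i x) (F i x) ∂μ i) *
        √(∑ i ∈ s, h i * ∫ x, ddot (G i x) (G i x) ∂μ i)) := by
  refine (Finset.abs_sum_le_sum_abs _ _).trans ?_
  refine (Finset.sum_le_sum fun i hi =>
    (hF i hi).abs_integral_ddot_elastic_le (hG i hi) h0 h1).trans ?_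
  rw [← Finset.mul_sum]
  exact mul_le_mul_of_nonneg_left (sum_sqrt_mul_sqrt_le_weighted s hh
    (fun i => integral_ddot_self_nonneg _ _) fun i => integral_ddot_self_nonneg _ _) zero_le_two

theorem abs_integral_ddot_elastic_le {F G : Finset Plane → Plane → Mat}
    (hF : ∀ K ∈ T.elements, MatL2 (volume.restrict (cell K)) (F K))
    (hG : ∀ K ∈ T.elements, MatL2 (volume.restrict (cell K)) (G K))
    {κ : ℝ} (h0 : 0 < κ) (h1 : κ < 1 / 2) :
    |T.integral fun K x => ddot (F K x) (elastic κ (G K x))| ≤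
      2 * (√(T.integral fun K x => ddot (F K x) (F K x)) *
        √(T.integral fun K x => ddot (G K x) (G K x))) := by
  simpa [integral] using abs_sum_integral_ddot_elastic_le T.elements hF hG h0 h1 (h := fun _ => 1)
    (by simp)

theorem SigmaH.matL2 {l : ℕ} {τ : Plane → Mat} (hτ : τ ∈ T.SigmaH l) {K : Finset Plane}
    (hK : K ∈ T.elements) : MatL2 (volume.restrict (cell K)) τ :=
  fun i j => ((hτ.2.2 K hK i j).memSobolev 0).memLp

/-- A lifting tested with itself is bounded, by the discrete trace inequality, by the lifted
field. -/
theorem lifting_bound (hE : ∀ e ∈ T.edges, ∀ K ∈ T.adjacent e, IsEdgeOf θ e K)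
    (hθ : 0 < Real.sin θ) {l : ℕ} (hl : l ≤ 1)
    {E : Finset (Finset Plane)} (hsub : E ⊆ T.edges) {φ : Finset Plane → Plane → Mat}
    (hφ : ∀ e ∈ E, MatL2 (arcLength.restrict (hull e)) (φ e)) :
    (∀ K ∈ T.elements, MatL2 (volume.restrict (cell K)) (T.lifting l E φ)) ∧
      T.integral (fun _ x => ddot (T.lifting l E φ x) (T.lifting l E φ x)) ≤
        192 / Real.sin θ *
          ∑ e ∈ E, (size e)⁻¹ * ∫ x in hull e, ddot (φ e x) (φ e x) ∂arcLength := by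
  have hpos : ∀ e ∈ E, 0 < size e := fun e he => by
    obtain ⟨-, K, hK⟩ := mem_edges (hsub he)
    exact (hE e (hsub he) K hK).size_pos
  have hΦ : 0 ≤ ∑ e ∈ E, (size e)⁻¹ * ∫ x in hull e, ddot (φ e x) (φ e x) ∂arcLength :=
    Finset.sum_nonneg fun e he =>
      mul_nonneg (inv_nonneg.2 (hpos e he).le) (integral_ddot_self_nonneg _ _)
  by_cases hex : ∃ r, T.IsLifting l E φ r
  swap
  · rw [lifting, dif_neg hex]
    refine ⟨fun K _ i j => MemLp.zero', ?_⟩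
    have : T.integral (fun _ x => ddot ((0 : Plane → Mat) x) ((0 : Plane → Mat) x)) = 0 := by
      simp [integral, ddot]
    rw [this]
    positivity
  have hr : T.IsLifting l E φ (T.lifting l E φ) := by
    rw [lifting, dif_pos hex]
    exact hex.choose_spec
  set r := T.lifting l E φ
  have hrK : ∀ K ∈ T.elements, MatL2 (volume.restrict (cell K)) r := fun K hK =>
    SigmaH.matL2 hr.1 hK
  refine ⟨hrK, ?_⟩
  have hX0 : 0 ≤ T.integral (fun _ x => ddot (r x) (r x)) :=
    Finset.sum_nonneg fun K _ => integral_ddot_self_nonneg _ _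
  have havg : ∑ e ∈ E, size e * ∫ x in hull e,
      ddot (T.average (fun _ => r) e x) (T.average (fun _ => r) e x) ∂arcLength ≤
        192 / Real.sin θ * T.integral (fun _ x => ddot (r x) (r x)) := by
    refine (sum_size_mul_integral_average_le hsub (fun _ => r)
      (g := fun K i j => 64 / Real.sin θ * ∫ x in cell K, r x i j ^ 2)
      (fun K i j => mul_nonneg (by positivity) (integral_nonneg fun _ => sq_nonneg _))
      fun e he K hK i j => ?_).trans_eq ?_
    · refine (hE e (hsub he) K hK).integral_trace_sq_le_of_isPolyOn ?_
      obtain ⟨p, hp, hp'⟩ := hr.1.2.2 K (mem_adjacent.1 hK).1 i j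
      exact ⟨p, hp.trans hl, hp'⟩
    · rw [integral, Finset.mul_sum, Finset.mul_sum]
      refine Finset.sum_congr rfl fun K hK => ?_
      rw [(hrK K hK).integral_ddot_self]
      simp only [Finset.mul_sum]
      refine Finset.sum_congr rfl fun i _ => Finset.sum_congr rfl fun j _ => ?_
      ring
  -- with `r` as a test function, `X ≤ √Φ √(C X)`, hence `X ≤ C Φ`
  have htest := hr.2 r hr.1
  set X := T.integral (fun _ x => ddot (r x) (r x))
  set Φ := ∑ e ∈ E, (size e)⁻¹ * ∫ x in hull e, ddot (φ e x) (φ e x) ∂arcLength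
  have h1 : X ≤ √Φ * √(192 / Real.sin θ * X) := by
    rw [htest]
    refine (neg_le_abs _).trans ((Finset.abs_sum_le_sum_abs _ _).trans ?_)
    refine (Finset.sum_le_sum fun e he =>
      (hφ e he).abs_integral_ddot_le (matL2_average (fun _ => r) e)).trans ?_
    refine (sum_sqrt_mul_sqrt_le_weighted E hpos (fun e => integral_ddot_self_nonneg _ _)
      fun e => integral_ddot_self_nonneg _ _).trans ?_
    gcongr
    rw [htest] at havg
    exact havg
  rw [← Real.sqrt_mul hΦ] at h1
  have h2 : X ^ 2 ≤ Φ * (192 / Real.sin θ * X) := by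
    calc X ^ 2 ≤ √(Φ * (192 / Real.sin θ * X)) ^ 2 := by gcongr
      _ = _ := Real.sq_sqrt (by positivity)
  rcases hX0.eq_or_lt with h | h
  · rw [← h]; positivity
  · refine le_of_mul_le_mul_right ?_ h
    linarith

/-! ### The energy norm and the terms of the primal forms -/

variable {Γ₁ Γ₂ Γ₃ : Set Plane} {v w : Plane → ℝ}

theorem integral_hessian_nonneg (v : Plane → ℝ) :
    0 ≤ T.integral fun K x => ddot (brokenHessian v K x) (brokenHessian v K x) :=
  Finset.sum_nonneg fun _ _ => integral_ddot_self_nonneg _ _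

theorem sum_jump_nonneg (E : Finset (Finset Plane)) (v : Plane → ℝ) :
    0 ≤ ∑ e ∈ E, (size e)⁻¹ * ∫ x in hull e, ddot (T.jump v e x) (T.jump v e x) ∂arcLength :=
  Finset.sum_nonneg fun _ _ =>
    mul_nonneg (inv_nonneg.2 Metric.diam_nonneg) (integral_ddot_self_nonneg _ _)

theorem sum_thirdDeriv_nonneg (v : Plane → ℝ) :
    0 ≤ ∑ K ∈ T.elements,
      size K ^ 2 * ∑ i, ∑ j, ∑ k, ∫ x in cell K, thirdDeriv (cell K) v i j k x ^ 2 :=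
  Finset.sum_nonneg fun _ _ => mul_nonneg (sq_nonneg _) <| Finset.sum_nonneg fun _ _ =>
    Finset.sum_nonneg fun _ _ => Finset.sum_nonneg fun _ _ => integral_nonneg fun _ => sq_nonneg _

theorem energyNorm_nonneg (Γ₂ Γ₃ : Set Plane) (v : Plane → ℝ) : 0 ≤ T.energyNorm Γ₂ Γ₃ v :=
  Real.sqrt_nonneg _

theorem energyNorm_sq (Γ₂ Γ₃ : Set Plane) (v : Plane → ℝ) :
    T.energyNorm Γ₂ Γ₃ v ^ 2 =
      (T.integral fun K x => ddot (brokenHessian v K x) (brokenHessian v K x)) +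
      (∑ e ∈ T.edges₀ Γ₂ Γ₃, (size e)⁻¹ *
        ∫ x in hull e, ddot (T.jump v e x) (T.jump v e x) ∂arcLength) +
      ∑ K ∈ T.elements,
        size K ^ 2 * ∑ i, ∑ j, ∑ k, ∫ x in cell K, thirdDeriv (cell K) v i j k x ^ 2 := by
  have h1 := T.integral_hessian_nonneg v
  have h2 := T.sum_jump_nonneg (T.edges₀ Γ₂ Γ₃) v
  have h3 := T.sum_thirdDeriv_nonneg v
  rw [energyNorm, Real.sq_sqrt, starSq]
  rw [starSq]
  positivity

theorem sqrt_integral_hessian_le (v : Plane → ℝ) :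
    √(T.integral fun K x => ddot (brokenHessian v K x) (brokenHessian v K x)) ≤
      T.energyNorm Γ₂ Γ₃ v := by
  refine Real.sqrt_le_iff.2 ⟨energyNorm_nonneg _ _ _, ?_⟩
  rw [energyNorm_sq]
  linarith [T.sum_jump_nonneg (T.edges₀ Γ₂ Γ₃) v, T.sum_thirdDeriv_nonneg v]

theorem sum_jump_le (v : Plane → ℝ) :
    ∑ e ∈ T.edges₀ Γ₂ Γ₃, (size e)⁻¹ *
      ∫ x in hull e, ddot (T.jump v e x) (T.jump v e x) ∂arcLength ≤
        T.energyNorm Γ₂ Γ₃ v ^ 2 := by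
  rw [energyNorm_sq]
  linarith [T.integral_hessian_nonneg v, T.sum_thirdDeriv_nonneg v]

theorem sqrt_sum_jump_le (v : Plane → ℝ) :
    √(∑ e ∈ T.edges₀ Γ₂ Γ₃, (size e)⁻¹ *
      ∫ x in hull e, ddot (T.jump v e x) (T.jump v e x) ∂arcLength) ≤ T.energyNorm Γ₂ Γ₃ v :=
  Real.sqrt_le_iff.2 ⟨energyNorm_nonneg _ _ _, sum_jump_le v⟩

/-- The trace inequality for second derivatives bounds the averages of the broken Hessian. -/
theorem sqrt_sum_average_hessian_le (hE : ∀ e ∈ T.edges, ∀ K ∈ T.adjacent e, IsEdgeOf θ e K)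
    (hθ : 0 < Real.sin θ) (hv : v ∈ T.VSum Γ₁) :
    √(∑ e ∈ T.edges₀ Γ₂ Γ₃, size e * ∫ x in hull e, ddot (T.average (brokenHessian v) e x)
      (T.average (brokenHessian v) e x) ∂arcLength) ≤
        √(192 / Real.sin θ) * T.energyNorm Γ₂ Γ₃ v := by
  rw [← Real.sqrt_sq (energyNorm_nonneg Γ₂ Γ₃ v), ← Real.sqrt_mul (by positivity)]
  refine Real.sqrt_le_sqrt ?_
  have hsub := T.edges₀_subset Γ₂ Γ₃
  refine (sum_size_mul_integral_average_le hsub (brokenHessian v)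
    (g := fun K i j => 64 / Real.sin θ * ((∫ x in cell K, brokenHessian v K x i j ^ 2) +
      size K ^ 2 * ∑ k, ∫ x in cell K, thirdDeriv (cell K) v i j k x ^ 2))
    (fun K i j => ?_) fun e he K hK i j => ?_).trans ?_
  · have h1 : 0 ≤ ∫ x in cell K, brokenHessian v K x i j ^ 2 :=
      integral_nonneg fun _ => sq_nonneg _
    have h2 : 0 ≤ ∑ k, ∫ x in cell K, thirdDeriv (cell K) v i j k x ^ 2 :=
      Finset.sum_nonneg fun _ _ => integral_nonneg fun _ => sq_nonneg _
    positivity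
  · exact (hE e (hsub he) K hK).integral_trace_sq_le _
  · rw [energyNorm_sq]
    have e1 : ∑ K ∈ T.elements, ∑ i, ∑ j, 64 / Real.sin θ *
        ((∫ x in cell K, brokenHessian v K x i j ^ 2) +
          size K ^ 2 * ∑ k, ∫ x in cell K, thirdDeriv (cell K) v i j k x ^ 2) =
        64 / Real.sin θ *
          ((T.integral fun K x => ddot (brokenHessian v K x) (brokenHessian v K x)) +
          ∑ K ∈ T.elements,
            size K ^ 2 * ∑ i, ∑ j, ∑ k, ∫ x in cell K, thirdDeriv (cell K) v i j k x ^ 2) := by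
      rw [integral, ← Finset.sum_add_distrib, Finset.mul_sum]
      refine Finset.sum_congr rfl fun K hK => ?_
      rw [MatL2.integral_ddot_self fun i j => memLp_brokenHessian T hv hK i j]
      simp only [Finset.mul_sum, mul_add, Finset.sum_add_distrib]
    rw [e1]
    have h2 := T.sum_jump_nonneg (T.edges₀ Γ₂ Γ₃) v
    have h3 : 0 ≤ 192 / Real.sin θ * ∑ e ∈ T.edges₀ Γ₂ Γ₃, (size e)⁻¹ *
        ∫ x in hull e, ddot (T.jump v e x) (T.jump v e x) ∂arcLength := by positivity
    have e2 : 192 / Real.sin θ = 3 * (64 / Real.sin θ) := by ring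
    rw [e2] at h3 ⊢
    nlinarith

theorem abs_bulkForm_le {κ : ℝ} (h0 : 0 < κ) (h1 : κ < 1 / 2) (hw : w ∈ T.VSum Γ₁)
    (hv : v ∈ T.VSum Γ₁) :
    |T.bulkForm κ w v| ≤ 2 * (T.energyNorm Γ₂ Γ₃ w * T.energyNorm Γ₂ Γ₃ v) := by
  have hwL : ∀ K ∈ T.elements, MatL2 (volume.restrict (cell K)) (brokenHessian w K) :=
    fun K hK i j => memLp_brokenHessian T hw hK i j
  have hvL : ∀ K ∈ T.elements, MatL2 (volume.restrict (cell K)) (brokenHessian v K) :=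
    fun K hK i j => memLp_brokenHessian T hv hK i j
  have htr : ∀ {μ : Measure Plane} {F : Plane → Mat}, MatL2 μ F →
      MemLp (fun x => (F x).trace) 2 μ := by
    intro μ F hF
    simp only [Matrix.trace, Fin.sum_univ_two, Matrix.diag_apply]
    exact (hF 0 0).add (hF 1 1)
  have e : T.bulkForm κ w v =
      T.integral fun K x => ddot (brokenHessian w K x) (elastic κ (brokenHessian v K x)) := by
    simp only [bulkForm, integral, ddot_elastic, ← Finset.sum_add_distrib]
    refine Finset.sum_congr rfl fun K hK => ?_
    exact (integral_add (((hwL K hK).integrable_ddot (hvL K hK)).const_mul _)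
      (((htr (hwL K hK)).integrable_mul (htr (hvL K hK))).const_mul _)).symm
  rw [e]
  refine (abs_integral_ddot_elastic_le hwL hvL h0 h1).trans ?_
  gcongr <;> first | exact energyNorm_nonneg _ _ _ | exact sqrt_integral_hessian_le _

theorem abs_edgeForm_le (hE : ∀ e ∈ T.edges, ∀ K ∈ T.adjacent e, IsEdgeOf θ e K)
    (hpos : ∀ e ∈ T.edges, 0 < size e) (hθ : 0 < Real.sin θ)
    {κ : ℝ} (h0 : 0 < κ) (h1 : κ < 1 / 2) (w : Plane → ℝ) (hv : v ∈ T.VSum Γ₁) :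
    |T.edgeForm κ Γ₂ Γ₃ w v| ≤
      2 * √(192 / Real.sin θ) * (T.energyNorm Γ₂ Γ₃ w * T.energyNorm Γ₂ Γ₃ v) := by
  refine (abs_sum_integral_ddot_elastic_le (T.edges₀ Γ₂ Γ₃) (fun e _ => matL2_jump w e)
    (fun e _ => matL2_average (brokenHessian v) e) h0 h1
    (fun e he => hpos e (T.edges₀_subset Γ₂ Γ₃ he))).trans ?_
  calc _ ≤ 2 * (T.energyNorm Γ₂ Γ₃ w * (√(192 / Real.sin θ) * T.energyNorm Γ₂ Γ₃ v)) := by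
        gcongr
        · exact energyNorm_nonneg _ _ _
        · exact sqrt_sum_jump_le w
        · exact sqrt_sum_average_hessian_le hE hθ hv
    _ = _ := by ring

theorem abs_penaltyForm_le {η : Finset Plane → ℝ} {η₁ : ℝ} (hη₁ : 0 ≤ η₁)
    (hη : ∀ e ∈ T.edges₀ Γ₂ Γ₃, 0 < η e ∧ η e ≤ η₁) (w v : Plane → ℝ) :
    |T.penaltyForm η Γ₂ Γ₃ w v| ≤ η₁ * (T.energyNorm Γ₂ Γ₃ w * T.energyNorm Γ₂ Γ₃ v) := by
  set a : (Plane → ℝ) → Finset Plane → ℝ := fun v e => (size e)⁻¹ *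
    ∫ x in hull e, ddot (T.jump v e x) (T.jump v e x) ∂arcLength with ha
  have hs : ∀ e : Finset Plane, 0 ≤ (size e)⁻¹ := fun e => inv_nonneg.2 Metric.diam_nonneg
  have ha0 : ∀ v e, 0 ≤ a v e := fun v e => mul_nonneg (hs e) (integral_ddot_self_nonneg _ _)
  refine (Finset.abs_sum_le_sum_abs _ _).trans ?_
  have hterm : ∀ e ∈ T.edges₀ Γ₂ Γ₃, |∫ x in hull e,
      η e * (size e)⁻¹ * ddot (T.jump w e x) (T.jump v e x) ∂arcLength| ≤
        η₁ * (√(a w e) * √(a v e)) := by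
    intro e he
    rw [integral_const_mul, abs_mul, abs_of_nonneg (mul_nonneg (hη e he).1.le (hs e))]
    calc _ ≤ η₁ * (size e)⁻¹ * (√(∫ x in hull e, ddot (T.jump w e x) (T.jump w e x) ∂arcLength) *
          √(∫ x in hull e, ddot (T.jump v e x) (T.jump v e x) ∂arcLength)) := by
          gcongr
          · exact mul_nonneg hη₁ (hs e)
          · exact hs e
          · exact (hη e he).2
          · exact (matL2_jump w e).abs_integral_ddot_le (matL2_jump v e)
      _ = η₁ * (√(a w e) * √(a v e)) := by
          simp only [ha, Real.sqrt_mul (hs e)]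
          nth_rewrite 1 [← Real.mul_self_sqrt (hs e)]
          ring
  refine (Finset.sum_le_sum hterm).trans ?_
  rw [← Finset.mul_sum]
  gcongr
  refine (Real.sum_sqrt_mul_sqrt_le _ (ha0 w) (ha0 v)).trans ?_
  gcongr
  · exact energyNorm_nonneg _ _ _
  · exact sqrt_sum_jump_le w
  · exact sqrt_sum_jump_le v

theorem abs_globalLiftForm_le (hE : ∀ e ∈ T.edges, ∀ K ∈ T.adjacent e, IsEdgeOf θ e K)
    (hθ : 0 < Real.sin θ) {κ : ℝ} (h0 : 0 < κ) (h1 : κ < 1 / 2) {l : ℕ} (hl : l ≤ 1)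
    (w v : Plane → ℝ) :
    |T.globalLiftForm κ l Γ₂ Γ₃ w v| ≤
      2 * (192 / Real.sin θ) * (T.energyNorm Γ₂ Γ₃ w * T.energyNorm Γ₂ Γ₃ v) := by
  have hB : ∀ v, _ := fun v => lifting_bound hE hθ hl (T.edges₀_subset Γ₂ Γ₃)
    (φ := T.jump v) fun e _ => matL2_jump v e
  have hX : ∀ v, √(T.integral fun _ x =>
      ddot (T.globalLift l Γ₂ Γ₃ v x) (T.globalLift l Γ₂ Γ₃ v x)) ≤
        √(192 / Real.sin θ) * T.energyNorm Γ₂ Γ₃ v := by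
    intro v
    rw [← Real.sqrt_sq (energyNorm_nonneg Γ₂ Γ₃ v), ← Real.sqrt_mul (by positivity)]
    refine Real.sqrt_le_sqrt ((hB v).2.trans ?_)
    gcongr
    exact sum_jump_le v
  refine (abs_integral_ddot_elastic_le (F := fun _ => T.globalLift l Γ₂ Γ₃ v)
    (G := fun _ => T.globalLift l Γ₂ Γ₃ w) (hB v).1 (hB w).1 h0 h1).trans ?_
  have hM : 0 ≤ 192 / Real.sin θ := by positivity
  calc _ ≤ 2 * ((√(192 / Real.sin θ) * T.energyNorm Γ₂ Γ₃ v) *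
        (√(192 / Real.sin θ) * T.energyNorm Γ₂ Γ₃ w)) := by
        gcongr
        · exact mul_nonneg (Real.sqrt_nonneg _) (energyNorm_nonneg _ _ _)
        · exact hX v
        · exact hX w
    _ = 2 * (√(192 / Real.sin θ) * √(192 / Real.sin θ)) *
        (T.energyNorm Γ₂ Γ₃ w * T.energyNorm Γ₂ Γ₃ v) := by ring
    _ = _ := by rw [Real.mul_self_sqrt hM]

theorem abs_localLiftForm_le (hE : ∀ e ∈ T.edges, ∀ K ∈ T.adjacent e, IsEdgeOf θ e K)
    (hθ : 0 < Real.sin θ) {κ : ℝ} (h0 : 0 < κ) (h1 : κ < 1 / 2) {l : ℕ} (hl : l ≤ 1)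
    {η : Finset Plane → ℝ} {η₁ : ℝ} (hη₁ : 0 ≤ η₁)
    (hη : ∀ e ∈ T.edges₀ Γ₂ Γ₃, 0 < η e ∧ η e ≤ η₁) (w v : Plane → ℝ) :
    |T.localLiftForm κ η l Γ₂ Γ₃ w v| ≤
      2 * η₁ * (192 / Real.sin θ) * (T.energyNorm Γ₂ Γ₃ w * T.energyNorm Γ₂ Γ₃ v) := by
  set a : (Plane → ℝ) → Finset Plane → ℝ := fun v e => (size e)⁻¹ *
    ∫ x in hull e, ddot (T.jump v e x) (T.jump v e x) ∂arcLength with ha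
  have hM : 0 ≤ 192 / Real.sin θ := by positivity
  have ha0 : ∀ v e, 0 ≤ a v e := fun v e =>
    mul_nonneg (inv_nonneg.2 Metric.diam_nonneg) (integral_ddot_self_nonneg _ _)
  have hB : ∀ v, ∀ e ∈ T.edges₀ Γ₂ Γ₃, _ := fun v e he => lifting_bound hE hθ hl
    (Finset.singleton_subset_iff.2 (T.edges₀_subset Γ₂ Γ₃ he)) (φ := T.jump v)
    fun e _ => matL2_jump v e
  have hX : ∀ v, ∀ e ∈ T.edges₀ Γ₂ Γ₃, √(T.integral fun _ x =>
      ddot (T.localLift l e v x) (T.localLift l e v x)) ≤ √(192 / Real.sin θ) * √(a v e) := by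
    intro v e he
    rw [← Real.sqrt_mul hM]
    refine Real.sqrt_le_sqrt ((hB v e he).2.trans_eq ?_)
    rw [Finset.sum_singleton]
  refine (Finset.abs_sum_le_sum_abs _ _).trans ?_
  have hterm : ∀ e ∈ T.edges₀ Γ₂ Γ₃, |T.integral fun _ x =>
      η e * ((1 - κ) * ddot (T.localLift l e w x) (T.localLift l e v x) +
        κ * ((T.localLift l e w x).trace * (T.localLift l e v x).trace))| ≤
          2 * η₁ * (192 / Real.sin θ) * (√(a w e) * √(a v e)) := by
    intro e he
    have e1 : (T.integral fun _ x =>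
        η e * ((1 - κ) * ddot (T.localLift l e w x) (T.localLift l e v x) +
          κ * ((T.localLift l e w x).trace * (T.localLift l e v x).trace))) =
        η e * T.integral fun _ x =>
          ddot (T.localLift l e w x) (elastic κ (T.localLift l e v x)) := by
      simp only [integral, ddot_elastic, integral_const_mul, Finset.mul_sum]
    rw [e1, abs_mul, abs_of_pos (hη e he).1]
    calc _ ≤ η₁ * (2 * ((√(192 / Real.sin θ) * √(a w e)) * (√(192 / Real.sin θ) * √(a v e)))) := by
          gcongr
          · exact (hη e he).2
          · refine (abs_integral_ddot_elastic_le (F := fun _ => T.localLift l e w)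
              (G := fun _ => T.localLift l e v) (hB w e he).1 (hB v e he).1 h0 h1).trans ?_
            gcongr
            · exact hX w e he
            · exact hX v e he
      _ = 2 * η₁ * (√(192 / Real.sin θ) * √(192 / Real.sin θ)) * (√(a w e) * √(a v e)) := by ring
      _ = _ := by rw [Real.mul_self_sqrt hM]
  refine (Finset.sum_le_sum hterm).trans ?_
  rw [← Finset.mul_sum]
  gcongr
  refine (Real.sum_sqrt_mul_sqrt_le _ (ha0 w) (ha0 v)).trans ?_
  gcongr
  · exact energyNorm_nonneg _ _ _
  · exact sqrt_sum_jump_le w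
  · exact sqrt_sum_jump_le v

end Triangulation

end KirchhoffDG

theorem mainTheorem4 (θ₀ η₁ : ℝ) (hθ₀ : 0 < θ₀) (hη₁ : 0 < η₁) :
    ∃ C : ℝ, 0 < C ∧
      ∀ (Ω Γ₁ Γ₂ Γ₃ : Set KirchhoffDG.Plane),
        KirchhoffDG.IsPolygonalDomain Ω →
        KirchhoffDG.IsBoundaryDecomposition Ω Γ₁ Γ₂ Γ₃ →
      ∀ (T : KirchhoffDG.Triangulation Ω), T.MinAngle θ₀ →
      ∀ κ : ℝ, 0 < κ → κ < 1 / 2 →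
      ∀ η : Finset KirchhoffDG.Plane → ℝ,
        (∀ e ∈ T.edges₀ Γ₂ Γ₃, 0 < η e ∧ η e ≤ η₁) →
      ∀ l : ℕ, l ≤ 1 →
      ∀ j : Fin 5, ∀ w ∈ T.VSum Γ₁, ∀ v ∈ T.VSum Γ₁,
        T.primalForm κ η l Γ₂ Γ₃ j w v ≤
          C * (T.energyNorm Γ₂ Γ₃ w * T.energyNorm Γ₂ Γ₃ v) := by
  -- for `θ₀ > π / 3` there are no triangles, but `sin θ₀` need not be positive then
  have hsin : 0 < Real.sin (min θ₀ 1) :=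
    Real.sin_pos_of_pos_of_lt_pi (lt_min hθ₀ one_pos)
      ((min_le_right _ _).trans_lt (by linarith [Real.pi_gt_three]))
  set M : ℝ := 192 / Real.sin (min θ₀ 1) with hM
  have hM0 : 0 < M := by positivity
  refine ⟨2 + 4 * √M + η₁ + 2 * M + 2 * η₁ * M, by positivity, ?_⟩
  intro Ω Γ₁ Γ₂ Γ₃ _ _ T hT κ h0 h1 η hη l hl j w hw v hv
  have hE : ∀ e ∈ T.edges, ∀ K ∈ T.adjacent e, KirchhoffDG.IsEdgeOf (min θ₀ 1) e K :=
    fun e he K hK => KirchhoffDG.Triangulation.isEdgeOf hθ₀ hT he hK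
  have hpos : ∀ e ∈ T.edges, 0 < KirchhoffDG.size e := fun e he => by
    obtain ⟨-, K, hK⟩ := KirchhoffDG.Triangulation.mem_edges he
    exact (hE e he K hK).size_pos
  set N := T.energyNorm Γ₂ Γ₃ w * T.energyNorm Γ₂ Γ₃ v with hN
  have hN0 : 0 ≤ N := mul_nonneg (KirchhoffDG.Triangulation.energyNorm_nonneg _ _ _)
    (KirchhoffDG.Triangulation.energyNorm_nonneg _ _ _)
  have b1 := abs_le.1 (KirchhoffDG.Triangulation.abs_bulkForm_le (Γ₂ := Γ₂) (Γ₃ := Γ₃) h0 h1 hw hv)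
  have b2 := abs_le.1 (KirchhoffDG.Triangulation.abs_edgeForm_le (Γ₂ := Γ₂) (Γ₃ := Γ₃)
    hE hpos hsin h0 h1 w hv)
  have b3 := abs_le.1 (KirchhoffDG.Triangulation.abs_edgeForm_le (Γ₂ := Γ₂) (Γ₃ := Γ₃)
    hE hpos hsin h0 h1 v hw)
  have b4 := abs_le.1 (KirchhoffDG.Triangulation.abs_penaltyForm_le hη₁.le hη w v)
  have b5 := abs_le.1 (KirchhoffDG.Triangulation.abs_globalLiftForm_le (Γ₂ := Γ₂) (Γ₃ := Γ₃)
    hE hsin h0 h1 hl w v)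
  have b6 := abs_le.1 (KirchhoffDG.Triangulation.abs_localLiftForm_le hE hsin h0 h1 hl hη₁.le hη w v)
  rw [mul_comm (T.energyNorm Γ₂ Γ₃ v)] at b3
  rw [← hN] at b1 b2 b3 b4 b5 b6
  rw [← hM] at b2 b3 b5 b6
  have p1 : 0 ≤ √M * N := by positivity
  have p2 : 0 ≤ η₁ * N := by positivity
  have p3 : 0 ≤ M * N := by positivity
  have p4 : 0 ≤ η₁ * M * N := by positivity
  have e : (2 + 4 * √M + η₁ + 2 * M + 2 * η₁ * M) * N =
      2 * N + 4 * (√M * N) + η₁ * N + 2 * (M * N) + 2 * (η₁ * M * N) := by ring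
  rw [e]
  fin_cases j <;> simp only [KirchhoffDG.Triangulation.primalForm] <;>
    linarith [b1.2, b2.1, b2.2, b3.1, b3.2, b4.2, b5.2, b6.2]
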